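/- Let $n\ge 0$, let $B_1\subset\mathbb C^{n+1}$ be the open unit ball and $B_1^*=B_1\setminus\{0\}$. Let $\mathcal F^\infty(B_1)$ be the family of plurisubharmonic functions $u:B_1\to[-\infty,\infty)$ that are $S^1$-invariant ($u(e^{i\theta}z)=u(z)$ for all $\theta\in\mathbb R$) and real valued of class $C^2$ on $B_1^*$. For $u\in\mathcal F^\infty(B_1)$, $t<0$ and $\zeta\in\mathbb{CP}^n$, let $u_t(\zeta)$ be the value of $u$ at any point of norm $e^t$ on the complex line $\zeta$, and put $\dot u_t=\partial_t u_t$. For $A>0$ let $$M_A(u)=\sup_{\zeta\in\mathbb{CP}^n}\partial_t^+u_t(\zeta)\big|_{t=-A}.$$ With $d^c=\frac i2(\bar\partial-\partial)$, let $\omega_{FS}$ be the Fubini–Study form on $\mathbb{CP}^n$, equal to $\frac12\,dd^c\log(1+|\zeta|^2)$ in the affine chart $[1:\zeta^1:\dots:\zeta^n]$ (so $\int_{\mathbb{CP}^n}\omega_{FS}^n=\pi^n$), and let $$\Theta_2=\dot u_t\,\omega_{FS}+dd^c u_t$$ be regarded as a $(1,1)$-form on $\mathbb{CP}^n$ for each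 fixed $t$. Then there are positive constants $B_k=B(k,n)$ with $$B_0=1,\qquad B_{k+1}=\sum_{j=0}^{k}\binom kj B_j\quad(0\le k\le n-1),$$ such that for every $u\in\mathcal F^\infty(B_1)$ and every $A>0$ one has $0\le M_A(u)<+\infty$, and for every $t<-A$ and every integer $0\le k\le n$, $$\int_{\mathbb{CP}^n}(\dot u_t)^{n+1-k}\,\omega_{FS}^{n-k}\wedge\Theta_2^{k}\;\le\;B_k\,M_A(u)^n\int_{\mathbb{CP}^n}\dot u_t\,\omega_{FS}^n ,$$ where all the integrals converge absolutely. -/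

import Mathlib

open MeasureTheory Set
open scoped LinearAlgebra.Projectivization

noncomputable section

namespace ZeroMass

/-! ### Circular symmetric plurisubharmonic functions -/

/-- The space `ℂⁿ⁺¹` with its Euclidean norm. -/
abbrev Amb (n : ℕ) : Type := EuclideanSpace ℂ (Fin (n + 1))

/-- The mean value `(2π)⁻¹ ∫₀^{2π} u(z + e^{iθ} w) dθ` of an extended real function, as the
difference of the mean values of the positive and of the negative part. (For an upper
semicontinuous `u < ⊤` the first of them is finite.) -/
def circleMean {n : ℕ} (u : Amb n → EReal) (z w : Amb n) : EReal :=
  (((ENNReal.ofReal (2 * Real.pi))⁻¹ * ∫⁻ θ in Ioc (0 : ℝ) (2 * Real.pi),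
      (u (z + Complex.exp (θ * Complex.I) • w)).toENNReal : ENNReal) : EReal) -
  (((ENNReal.ofReal (2 * Real.pi))⁻¹ * ∫⁻ θ in Ioc (0 : ℝ) (2 * Real.pi),
      (-u (z + Complex.exp (θ * Complex.I) • w)).toENNReal : ENNReal) : EReal)

/-- Plurisubharmonic functions with values in `[-∞, ∞)`: upper semicontinuous, not identically
`-∞`, and satisfying the sub-mean value inequality on every closed disc of a complex line
that lies in the domain. -/
structure IsPlurisubharmonicOn {n : ℕ} (u : Amb n → EReal) (D : Set (Amb n)) : Prop where
  usc : UpperSemicontinuousOn u D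
  lt_top : ∀ z ∈ D, u z < ⊤
  exists_ne_bot : ∃ z ∈ D, u z ≠ ⊥
  le_circleMean : ∀ z w : Amb n, (∀ c : ℂ, ‖c‖ ≤ 1 → z + c • w ∈ D) → u z ≤ circleMean u z w

/-- The family `F^∞(B₁)`: the `S¹`-invariant plurisubharmonic functions on the open unit ball
that are (real valued and) of class `C²` on the punctured ball. -/
structure MemFInfty {n : ℕ} (u : Amb n → EReal) : Prop where
  psh : IsPlurisubharmonicOn u (Metric.ball 0 1)
  invariant : ∀ z ∈ Metric.ball (0 : Amb n) 1, ∀ θ : ℝ,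
    u (Complex.exp (θ * Complex.I) • z) = u z
  ne_bot : ∀ z ∈ Metric.ball (0 : Amb n) 1 \ {0}, u z ≠ ⊥
  contDiffOn : ContDiffOn ℝ 2 (fun z => (u z).toReal) (Metric.ball 0 1 \ {0})

/-! ### The functions `u_t` on projective space and the maximal directional Lelong number -/

/-- Complex projective space `ℂℙⁿ`, the space of complex lines through the origin. -/
abbrev CP (n : ℕ) : Type := ℙ ℂ (Amb n)

/-- `u_t(ζ)`: the value of `u` at a point of norm `eᵗ` on the line `ζ`. For an `S¹`-invariant
`u` and `t < 0` it does not depend on the chosen point. -/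
def slice {n : ℕ} (u : Amb n → EReal) (t : ℝ) (ζ : CP n) : ℝ :=
  (u (((Real.exp t / ‖ζ.rep‖ : ℝ) : ℂ) • ζ.rep)).toReal

/-- The derivative `∂u_t(ζ)/∂t`. -/
def sliceDeriv {n : ℕ} (u : Amb n → EReal) (t : ℝ) (ζ : CP n) : ℝ :=
  deriv (fun s => slice u s ζ) t

/-- The maximal directional Lelong number `M_A(u)` at distance `A`: the supremum over `ζ ∈ ℂℙⁿ`
of the right derivatives of `t ↦ u_t(ζ)` at `t = -A`. -/
def maxDirLelong {n : ℕ} (u : Amb n → EReal) (A : ℝ) : EReal :=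
  ⨆ ζ : CP n, ((derivWithin (fun s => slice u s ζ) (Ici (-A)) (-A) : ℝ) : EReal)

/-! ### Differential forms in an affine chart of projective space -/

/-- The model space `ℂⁿ` of the affine chart of `ℂℙⁿ`. -/
abbrev Aff (n : ℕ) : Type := Fin n → ℂ

/-- The affine chart `(ζ¹, …, ζⁿ) ↦ [1 : ζ¹ : … : ζⁿ]`. Its image is the complement of the
hyperplane `z⁰ = 0`. -/
def chart {n : ℕ} (ζ : Aff n) : CP n :=
  Projectivization.mk ℂ (WithLp.toLp 2 (Fin.cons 1 ζ : Fin (n + 1) → ℂ)) (by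
    intro h
    have h0 := congrArg (fun v : Amb n => v 0) h
    simp at h0)

/-- Real covectors on `ℂⁿ`. -/
abbrev Covec (n : ℕ) : Type := Aff n →L[ℝ] ℝ

/-- Real exterior forms on `ℂⁿ`; the wedge product is the product of this algebra. A differential
form on the chart is a function `Aff n → Forms n`. -/
abbrev Forms (n : ℕ) : Type := ExteriorAlgebra ℝ (Covec n)

/-- The coordinate vectors `∂/∂x^a` (for `(a, 0)`) and `∂/∂y^a` (for `(a, 1)`), where
`ζ^a = x^a + i y^a`. -/
def frame (n : ℕ) (p : Fin n × Fin 2) : Aff n :=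
  Pi.single p.1 (if p.2 = 0 then 1 else Complex.I)

/-- The coordinate covectors `dx^a` (for `(a, 0)`) and `dy^a` (for `(a, 1)`). -/
def coframe (n : ℕ) (p : Fin n × Fin 2) : Covec n :=
  (if p.2 = 0 then Complex.reCLM else Complex.imCLM).comp
    (ContinuousLinearMap.proj (R := ℝ) (φ := fun _ : Fin n => ℂ) p.1)

/-- Multiplication by `i` on `ℂⁿ`, as a real linear map. -/
def mulI (n : ℕ) : Aff n →L[ℝ] Aff n :=
  Complex.I • ContinuousLinearMap.id ℝ (Aff n)

/-- The `1`-form `d^c f = (i/2)(∂̄f - ∂f)`, that is, `(d^c f)(v) = -(1/2) df(iv)`. -/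
def dc {n : ℕ} (f : Aff n → ℝ) (ζ : Aff n) : Covec n :=
  (-(1 / 2) : ℝ) • (fderiv ℝ f ζ).comp (mulI n)

/-- The exterior derivative `dα = ∑ⱼ dxʲ ∧ ∂ⱼα` of a `1`-form, summed over the `2n` real
coordinates. -/
def extD {n : ℕ} (α : Aff n → Covec n) (ζ : Aff n) : Forms n :=
  ∑ p : Fin n × Fin 2, ExteriorAlgebra.ι ℝ (coframe n p) *
    ExteriorAlgebra.ι ℝ (fderiv ℝ α ζ (frame n p))

/-- The `2`-form `d d^c f`. -/
def ddc {n : ℕ} (f : Aff n → ℝ) : Aff n → Forms n := extD (dc f)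

/-- The Fubini–Study form `(1/2) d d^c log (1 + |ζ|²)`, of total volume `∫ ω^n = πⁿ`. -/
def omegaFS {n : ℕ} (ζ : Aff n) : Forms n :=
  (1 / 2 : ℝ) • ddc (fun ξ : Aff n => Real.log (1 + ∑ a, ‖ξ a‖ ^ 2)) ζ

/-- The `2`-form `Θ₂ = (∂u_t/∂t) ω_FS + d d^c u_t` on `ℂℙⁿ`. -/
def Theta₂ {n : ℕ} (u : Amb n → EReal) (t : ℝ) (ζ : Aff n) : Forms n :=
  sliceDeriv u t (chart ζ) • omegaFS ζ + ddc (fun ξ => slice u t (chart ξ)) ζ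

/-- The alternating `2n`-form on covectors `(α₁, …, α₂ₙ) ↦ det (α_i(∂_j))`, for the frame
`∂/∂x¹, ∂/∂y¹, …, ∂/∂xⁿ, ∂/∂yⁿ`. -/
def topDet (n : ℕ) : Covec n [⋀^Fin (n * 2)]→ₗ[ℝ] ℝ :=
  (Matrix.detRowAlternating.compLinearMap
    (LinearMap.pi fun p => (ContinuousLinearMap.apply ℝ ℝ (frame n p)).toLinearMap)).domDomCongr
      finProdFinEquiv

/-- The coefficient of `dx¹ ∧ dy¹ ∧ ⋯ ∧ dxⁿ ∧ dyⁿ` in an exterior form. -/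
def topCoeff (n : ℕ) : Forms n →ₗ[ℝ] ℝ :=
  ExteriorAlgebra.liftAlternating (R := ℝ)
    (Pi.single (M := fun m => Covec n [⋀^Fin m]→ₗ[ℝ] ℝ) (n * 2) (topDet n))

/-- Absolute integrability over `ℂℙⁿ` of the top degree part of a form. -/
def IntegrableForm {n : ℕ} (Φ : Aff n → Forms n) : Prop :=
  Integrable (fun ζ : Aff n => topCoeff n (Φ ζ))

/-- The integral over `ℂℙⁿ` (with its complex orientation) of the top degree part of a form,
computed in the affine chart, which covers `ℂℙⁿ` up to a null set. -/
def integralCP {n : ℕ} (Φ : Aff n → Forms n) : ℝ :=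
  ∫ ζ : Aff n, topCoeff n (Φ ζ)

end ZeroMass

end

noncomputable section

namespace ZeroMass

/-! ### Coordinates and exterior products of covectors -/

/-! Write `a` for the `t`-derivative of `u_t`, `ω` for the Fubini–Study form, `F` for `u_t`, `Θ = a
ω + dd^c F` and `M = M_A(u)`. Two facts about `u` suffice: `0 ≤ a ≤ M`, and `Θ` is semipositive. The
rest is a comparison of masses.

The bounds on `a`: circular invariance turns the Levi form in the radial direction into the second
derivative in `t = log ‖z‖`, so `u` is convex in `t` and `a` increases with `t`
(`MemFInfty.monotoneOn_fderiv_ray`, `MemFInfty.sliceDeriv_le`). It is nonnegative because `u` is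
bounded above near the origin (`MemFInfty.fderiv_ray_nonneg`), and `M` is finite by compactness of a
sphere. For `Θ`, the Hessian of `u_t` in the chart is computed along curves that are rotated by a
phase, which `u` does not see. The velocity then depends complex linearly on the direction, and the
Levi form of `Θ` becomes a Levi form of `u` (`MemFInfty.levi_slice_chart_nonneg`).

The comparison: put `β = M ω + dd^c F`, which differs from `M ω` by an exact form. Its mass
satisfies `∫ ω^(n-k) ∧ β^k ≤ M^k ∫ ω^n` (`integral_omegaFS_pow_mul_le`). Since the integrals live in
an affine chart, `F` is first replaced by a compactly supported function equal, up to a constant, to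
`F` minus a small multiple of the Fubini–Study potential on a large ball; Stokes' theorem applies to
it after mollification. On the other hand `β = (M - a) ω + Θ` with both summands semipositive, so
the extreme terms of the binomial expansion give `ω^(n-k) ∧ Θ^k + (M - a)^k ω^n ≤ ω^(n-k) ∧ β^k` for
`k ≥ 1` (`topCoeff_add_le`). Integrating and using `M^k - (M - a)^k ≤ k M^(k-1) a` yields `∫ ω^(n-k)
∧ Θ^k ≤ k M^(k-1) ∫ a ω^n`.

Bounding `a^(n+1-k)` by `M^(n+1-k)` gives the estimate with constant `k` for `k ≥ 1`; for `k = 0` it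
is immediate with constant `1`. The recursion in the statement defines the Bell numbers, which
dominate these constants (`le_bell`); it plays no other role in the estimate. -/

open ExteriorAlgebra in
theorem ι_mul_ι_swap {n : ℕ} (a b : Covec n) : ι ℝ a * ι ℝ b = -(ι ℝ b * ι ℝ a) :=
  eq_neg_of_add_eq_zero_left (ExteriorAlgebra.ι_add_mul_swap a b)

theorem coframe_frame {n : ℕ} (p q : Fin n × Fin 2) :
    coframe n p (frame n q) = if p = q then 1 else 0 := by
  obtain ⟨a, i⟩ := p
  obtain ⟨b, j⟩ := q
  by_cases h : a = b
  · subst h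
    fin_cases i <;> fin_cases j <;> simp [coframe, frame]
  · fin_cases i <;> fin_cases j <;> simp [coframe, frame, h]

theorem sum_coframe_smul_frame {n : ℕ} (v : Aff n) :
    ∑ p, coframe n p v • frame n p = v := by
  ext a
  rw [Fintype.sum_prod_type]
  simp only [Fin.sum_univ_two, coframe, frame, Finset.sum_apply, Pi.add_apply, Pi.smul_apply]
  rw [Finset.sum_eq_single a]
  · simp [Complex.re_add_im]
  · intro b _ hb
    simp [Pi.single_eq_of_ne hb.symm]
  · simp

theorem sum_apply_frame_smul_coframe {n : ℕ} (l : Covec n) :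
    ∑ p, l (frame n p) • coframe n p = l := by
  ext v
  conv_rhs => rw [← sum_coframe_smul_frame v, map_sum]
  simp [mul_comm]

/-- The real basis `∂/∂x¹, ∂/∂y¹, …` of `ℂⁿ`. -/
def frameBasis (n : ℕ) : Module.Basis (Fin n × Fin 2) ℝ (Aff n) :=
  Module.Basis.ofEquivFun
    { toFun := fun v p => coframe n p v
      invFun := fun x => ∑ p, x p • frame n p
      map_add' := fun v w => by ext p; simp
      map_smul' := fun c v => by ext p; simp
      left_inv := fun v => sum_coframe_smul_frame v
      right_inv := fun x => by ext p; simp [coframe_frame] }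

theorem frameBasis_apply {n : ℕ} (p : Fin n × Fin 2) : frameBasis n p = frame n p := by
  classical
  simp [frameBasis, Pi.single_apply]

theorem frameBasis_repr {n : ℕ} (v : Aff n) (p : Fin n × Fin 2) :
    (frameBasis n).repr v p = coframe n p v := by
  rw [← Module.Basis.equivFun_apply]
  simp [frameBasis]

@[simp] theorem mulI_apply {n : ℕ} (v : Aff n) : mulI n v = Complex.I • v := by
  simp [mulI]

theorem mulI_mulI {n : ℕ} (v : Aff n) : mulI n (mulI n v) = -v := by
  simp [smul_smul]

/-- The elementary form `l ∧ (-l ∘ J)`. -/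
def elemForm {n : ℕ} (l : Covec n) : Forms n :=
  ExteriorAlgebra.ι ℝ l * ExteriorAlgebra.ι ℝ (-(l.comp (mulI n)))

/-- The complex linear map with component `l_i - √-1 l_i ∘ J`. -/
def complexRows {n : ℕ} (l : Fin n → Covec n) : Aff n →ₗ[ℂ] Aff n where
  toFun v i := (l i v : ℂ) - Complex.I * (l i (mulI n v) : ℂ)
  map_add' v w := by
    ext i
    simp only [map_add, Pi.add_apply, Complex.ofReal_add]
    ring
  map_smul' c v := by
    ext i
    have h : c • v = c.re • v + c.im • mulI n v := by
      ext a
      simp only [Pi.smul_apply, Pi.add_apply, smul_eq_mul, mulI_apply, Complex.real_smul]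
      conv_lhs => rw [← Complex.re_add_im c]
      ring
    have h' : mulI n (c • v) = c.re • mulI n v + c.im • (-v) := by
      rw [h, map_add, map_smul, map_smul, mulI_mulI]
    rw [h']
    simp only [h, map_add, map_smul, map_neg, RingHom.id_apply, Pi.smul_apply, smul_eq_mul,
      Complex.ofReal_add, Complex.ofReal_mul, Complex.ofReal_neg]
    conv_rhs => rw [← Complex.re_add_im c]
    ring_nf
    simp only [Complex.I_sq]
    ring

theorem topCoeff_prod_ι_mul_ι {n : ℕ} (a b : Fin n → Covec n) :
    topCoeff n (List.ofFn fun i => ExteriorAlgebra.ι ℝ (a i) * ExteriorAlgebra.ι ℝ (b i)).prod =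
      (Matrix.of fun p q : Fin n × Fin 2 =>
        (if p.2 = 0 then a p.1 else b p.1) (frame n q)).det := by
  set v : Fin (n * 2) → Covec n := fun j =>
    if (finProdFinEquiv.symm j).2 = 0 then a (finProdFinEquiv.symm j).1
      else b (finProdFinEquiv.symm j).1 with hv
  have h1 : (List.ofFn fun i => ExteriorAlgebra.ι ℝ (a i) * ExteriorAlgebra.ι ℝ (b i)).prod =
      ExteriorAlgebra.ιMulti ℝ (n * 2) v := by
    -- The `2n` covectors are listed as `a 0, b 0, a 1, b 1, …`; `finProdFinEquiv` sends `(i, j)` to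
    -- position `2 i + j`.
    rw [ExteriorAlgebra.ιMulti_apply, List.ofFn_mul, List.prod_flatten, List.map_ofFn]
    congr 2
    ext1 i
    have e (j : Fin 2) (h) : (finProdFinEquiv.symm (⟨i * 2 + j, h⟩ : Fin (n * 2))) = (i, j) := by
      rw [Equiv.symm_apply_eq]
      ext
      simp [finProdFinEquiv]
      ring
    simp only [Function.comp, List.ofFn_succ, List.ofFn_zero, List.prod_cons, List.prod_nil, hv, e]
    simp
  rw [h1, topCoeff, ExteriorAlgebra.liftAlternating_apply_ιMulti, Pi.single_eq_same, topDet,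
    AlternatingMap.domDomCongr_apply, AlternatingMap.compLinearMap_apply]
  change Matrix.det _ = _
  congr 1
  ext p q
  simp only [hv, Function.comp, LinearMap.pi_apply, Equiv.symm_apply_apply, Matrix.of_apply]
  rfl

/-- The covectors `l i` and `-(l i) ∘ J` are the real and imaginary parts of the rows of a complex
linear map, and the real determinant of such a map is the squared modulus of its complex
determinant. All positivity of wedge products rests on this. -/
theorem topCoeff_prod_elemForm {n : ℕ} (l : Fin n → Covec n) :
    topCoeff n (List.ofFn fun i => elemForm (l i)).prod =
      Complex.normSq (LinearMap.det (complexRows l)) := by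
  have h := LinearMap.det_restrictScalars (R := ℝ) (f := complexRows l)
  rw [Algebra.norm_complex_apply] at h
  rw [← h, ← LinearMap.det_toMatrix (frameBasis n)]
  simp only [elemForm]
  rw [topCoeff_prod_ι_mul_ι]
  congr 1
  ext ⟨i, k⟩ q
  rw [LinearMap.toMatrix_apply, frameBasis_repr, frameBasis_apply]
  fin_cases k <;> simp [coframe, complexRows]

/-! ### The `2`-form of a Hessian -/

/-- Real bilinear forms on `ℂⁿ`. -/
abbrev BilForm (n : ℕ) : Type := Aff n →L[ℝ] Aff n →L[ℝ] ℝ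

/-- The `2`-form `d d^c f` as a linear function of the Hessian of `f`. -/
def hessForm (n : ℕ) : BilForm n →ₗ[ℝ] Forms n where
  toFun H := ∑ p, ExteriorAlgebra.ι ℝ (coframe n p) *
    ExteriorAlgebra.ι ℝ ((-(1 / 2) : ℝ) • (H (frame n p)).comp (mulI n))
  map_add' H K := by
    simp only [add_apply, ContinuousLinearMap.add_comp, smul_add, map_add,
      mul_add, Finset.sum_add_distrib]
  map_smul' c H := by
    simp only [smul_apply, ContinuousLinearMap.smul_comp, map_smul,
      RingHom.id_apply, Finset.smul_sum, mul_smul_comm, smul_comm c]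

theorem hessForm_apply {n : ℕ} (H : BilForm n) :
    hessForm n H = ∑ p, ExteriorAlgebra.ι ℝ (coframe n p) *
      ExteriorAlgebra.ι ℝ ((-(1 / 2) : ℝ) • (H (frame n p)).comp (mulI n)) := rfl

theorem hasFDerivAt_dc {n : ℕ} {f : Aff n → ℝ} (hf : ContDiff ℝ 2 f) (ζ v : Aff n) :
    fderiv ℝ (dc f) ζ v = (-(1 / 2) : ℝ) • (fderiv ℝ (fderiv ℝ f) ζ v).comp (mulI n) := by
  have hd : DifferentiableAt ℝ (fderiv ℝ f) ζ :=
    ((hf.fderiv_right (m := 1) (by norm_num)).differentiable (by norm_num)) ζ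
  have h := (hd.hasFDerivAt.clm_comp (hasFDerivAt_const (mulI n) ζ)).const_smul (-(1 / 2) : ℝ)
  have h2 : HasFDerivAt (dc f) _ ζ := h
  rw [h2.fderiv]
  ext w
  simp

/-- Reduces pointwise questions about `dd^c` to linear algebra of Hessians, with only two
derivatives needed. -/
theorem ddc_eq_hessForm {n : ℕ} {f : Aff n → ℝ} (hf : ContDiff ℝ 2 f) (ζ : Aff n) :
    ddc f ζ = hessForm n (fderiv ℝ (fderiv ℝ f) ζ) := by
  simp only [ddc, extD, hessForm_apply, hasFDerivAt_dc hf]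

theorem hessForm_smulRight {n : ℕ} (l m : Covec n) :
    hessForm n (l.smulRight m) =
      (-(1 / 2) : ℝ) • (ExteriorAlgebra.ι ℝ l * ExteriorAlgebra.ι ℝ (m.comp (mulI n))) := by
  simp only [hessForm_apply, ContinuousLinearMap.smulRight_apply, ContinuousLinearMap.smul_comp,
    map_smul, mul_smul_comm, ← Finset.smul_sum]
  congr 1
  simp only [← smul_mul_assoc, ← map_smul, ← Finset.sum_mul, ← map_sum,
    sum_apply_frame_smul_coframe]

theorem hessForm_smulRight_self {n : ℕ} (l : Covec n) :
    hessForm n (l.smulRight l) = (1 / 2 : ℝ) • elemForm l := by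
  rw [hessForm_smulRight, elemForm, map_neg, mul_neg, smul_neg, neg_smul]

theorem comp_mulI_comp_mulI {n : ℕ} (l : Covec n) : (l.comp (mulI n)).comp (mulI n) = -l := by
  ext v
  change l (mulI n (mulI n v)) = - l v
  rw [mulI_mulI, map_neg]

theorem bilForm_eq_sum {n : ℕ} (H : BilForm n) :
    H = ∑ p, ∑ q, H (frame n p) (frame n q) • (coframe n p).smulRight (coframe n q) := by
  ext v w
  conv_lhs => rw [← sum_coframe_smul_frame v, ← sum_coframe_smul_frame w]
  simp only [map_sum, map_smul, sum_apply, smul_apply,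
    ContinuousLinearMap.smulRight_apply, smul_eq_mul]
  rw [Finset.sum_comm]
  refine Finset.sum_congr rfl fun p _ => ?_
  simp only [Finset.mul_sum]
  refine Finset.sum_congr rfl fun q _ => ?_
  ring

/-- The pullback of a bilinear form by multiplication by `i`. -/
def conjForm {n : ℕ} (H : BilForm n) : BilForm n := H.bilinearComp (mulI n) (mulI n)

theorem conjForm_apply {n : ℕ} (H : BilForm n) (v w : Aff n) :
    conjForm H v w = H (mulI n v) (mulI n w) := rfl

/-- This is the statement that `dd^c` is of type `(1, 1)`: on `l ⊗ m` the pullback by `J` exchanges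
the two factors up to sign, and symmetry of `H` undoes the exchange. -/
theorem hessForm_conjForm {n : ℕ} (H : BilForm n) (hH : ∀ v w, H v w = H w v) :
    hessForm n (conjForm H) = hessForm n H := by
  have key : conjForm H = ∑ p, ∑ q, H (frame n p) (frame n q) •
      ((coframe n p).comp (mulI n)).smulRight ((coframe n q).comp (mulI n)) := by
    ext v w
    conv_lhs => rw [bilForm_eq_sum H]
    simp only [conjForm_apply, sum_apply, smul_apply,
      ContinuousLinearMap.smulRight_apply, ContinuousLinearMap.comp_apply]
  rw [key]
  conv_rhs => rw [bilForm_eq_sum H]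
  simp only [map_sum, map_smul, hessForm_smulRight, comp_mulI_comp_mulI]
  rw [Finset.sum_comm]
  refine Finset.sum_congr rfl fun p _ => Finset.sum_congr rfl fun q _ => ?_
  rw [hH, map_neg, mul_neg, ι_mul_ι_swap ((coframe n q).comp (mulI n)), neg_neg]

/-! ### Positivity of `(1, 1)`-forms. -/

/-- The Levi form `H(v, v) + H(iv, iv)` of a real bilinear form. -/
def levi {n : ℕ} (H : BilForm n) (v : Aff n) : ℝ := H v v + H (mulI n v) (mulI n v)

theorem levi_add {n : ℕ} (H K : BilForm n) (v : Aff n) : levi (H + K) v = levi H v + levi K v := by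
  simp only [levi, add_apply]
  ring

theorem levi_smul {n : ℕ} (c : ℝ) (H : BilForm n) (v : Aff n) :
    levi (c • H) v = c * levi H v := by
  simp only [levi, smul_apply, smul_eq_mul]
  ring

theorem levi_smulRight_self_nonneg {n : ℕ} (l : Covec n) (v : Aff n) :
    0 ≤ levi (l.smulRight l) v := by
  exact add_nonneg (mul_self_nonneg _) (mul_self_nonneg _)

/-- Semipositive `(1, 1)`-forms. -/
def PosForm {n : ℕ} (Φ : Forms n) : Prop :=
  ∃ (m : ℕ) (l : Fin m → Covec n), Φ = ∑ k, (1 / 2 : ℝ) • elemForm (l k)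

/-- The Gram matrix in the real frame is positive semidefinite, hence a sum of rank one squares. -/
theorem exists_eq_sum_smulRight {n : ℕ} (S : BilForm n) (hS : ∀ v w, S v w = S w v)
    (hpos : ∀ v, 0 ≤ S v v) :
    ∃ (m : ℕ) (l : Fin m → Covec n), S = ∑ k, (l k).smulRight (l k) := by
  set G : Matrix (Fin n × Fin 2) (Fin n × Fin 2) ℝ :=
    Matrix.of fun p q => S (frame n p) (frame n q) with hG
  have hpsd : G.PosSemidef := by
    refine Matrix.PosSemidef.of_dotProduct_mulVec_nonneg ?_ fun x => ?_
    · ext p q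
      simp [hG, Matrix.conjTranspose_apply, hS (frame n q)]
    · have := hpos (∑ p, x p • frame n p)
      simp only [map_sum, map_smul, sum_apply, smul_apply,
        smul_eq_mul] at this
      refine this.trans_eq ?_
      simp only [dotProduct, Matrix.mulVec, hG, Matrix.of_apply, Pi.star_apply, star_trivial]
      simp only [Finset.mul_sum]
      rw [Finset.sum_comm]
      refine Finset.sum_congr rfl fun p _ => Finset.sum_congr rfl fun q _ => ?_
      ring
  obtain ⟨m, A, hA⟩ := Matrix.posSemidef_iff_eq_sum_vecMulVec.mp hpsd
  refine ⟨m, fun k => ∑ p, A k p • coframe n p, ?_⟩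
  conv_lhs => rw [bilForm_eq_sum S]
  have hG' (p q) : S (frame n p) (frame n q) = ∑ k, A k p * A k q := by
    have := congrFun (congrFun hA p) q
    simpa [hG, Matrix.sum_apply, Matrix.vecMulVec_apply] using this
  ext v w
  simp only [hG', sum_apply, smul_apply,
    ContinuousLinearMap.smulRight_apply, smul_eq_mul, Finset.sum_mul, Finset.mul_sum]
  rw [Finset.sum_congr rfl fun p _ => Finset.sum_comm, Finset.sum_comm]
  refine Finset.sum_congr rfl fun k _ => ?_
  rw [Finset.sum_comm]
  refine Finset.sum_congr rfl fun p _ => Finset.sum_congr rfl fun q _ => ?_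
  ring

theorem posForm_hessForm {n : ℕ} (H : BilForm n) (hH : ∀ v w, H v w = H w v)
    (hpos : ∀ v, 0 ≤ levi H v) : PosForm (hessForm n H) := by
  -- `H` itself need not be semidefinite, but its average under `J` is, by the Levi condition, and
  -- has the same image under `hessForm`.
  obtain ⟨m, l, hl⟩ := exists_eq_sum_smulRight ((1 / 2 : ℝ) • (H + conjForm H))
    (fun v w => by
      simp only [smul_apply, add_apply, conjForm_apply]
      rw [hH v, hH (mulI n v)])
    (fun v => by
      have := hpos v
      simp only [levi] at this
      simp only [smul_apply, add_apply, conjForm_apply,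
        smul_eq_mul]
      positivity)
  refine ⟨m, l, ?_⟩
  have h := congrArg (hessForm n) hl
  rw [map_smul, map_add, hessForm_conjForm H hH, ← two_smul ℝ, smul_smul, map_sum] at h
  norm_num at h
  simp only [h, hessForm_smulRight_self]

/-- The factors are expanded one at a time into elementary forms, which are collected in `A`; when
none is left, the coefficient is a squared modulus. -/
theorem topCoeff_prod_nonneg_aux {n : ℕ} (L : List (Forms n)) (hL : ∀ Φ ∈ L, PosForm Φ)
    (A : List (Covec n)) (hlen : A.length + L.length = n) :
    0 ≤ topCoeff n ((A.map elemForm).prod * L.prod) := by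
  induction L generalizing A with
  | nil =>
    simp only [List.length_nil, add_zero] at hlen
    have : A.map elemForm = List.ofFn fun i : Fin n => elemForm (A.get (i.cast hlen.symm)) := by
      refine List.ext_getElem (by simp [hlen]) fun i h1 h2 => ?_
      simp
    rw [List.prod_nil, mul_one, this, topCoeff_prod_elemForm]
    exact Complex.normSq_nonneg _
  | cons Φ L ih =>
    obtain ⟨m, l, rfl⟩ := hL Φ (by simp)
    rw [List.prod_cons, Finset.sum_mul, Finset.mul_sum, map_sum]
    refine Finset.sum_nonneg fun k _ => ?_
    rw [smul_mul_assoc, mul_smul_comm, map_smul]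
    have := ih (fun Ψ hΨ => hL Ψ (by simp [hΨ])) (A ++ [l k]) (by
      simp only [List.length_append, List.length_cons, List.length_nil] at hlen ⊢
      omega)
    simp only [List.map_append, List.map_cons, List.map_nil, List.prod_append, List.prod_cons,
      List.prod_nil, mul_one, mul_assoc] at this
    rw [smul_eq_mul]
    positivity

theorem topCoeff_pow_mul_pow_nonneg {n : ℕ} {Φ Ψ : Forms n} (hΦ : PosForm Φ) (hΨ : PosForm Ψ)
    {i j : ℕ} (h : i + j = n) : 0 ≤ topCoeff n (Φ ^ i * Ψ ^ j) := by
  have := topCoeff_prod_nonneg_aux (List.replicate i Φ ++ List.replicate j Ψ)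
    (fun X hX => by
      rcases List.mem_append.mp hX with hX | hX
      · rwa [List.eq_of_mem_replicate hX]
      · rwa [List.eq_of_mem_replicate hX]) [] (by simpa using h)
  simpa using this

/-! ### `2`-forms are central -/

theorem commute_of_commute_ι {n : ℕ} {Φ : Forms n}
    (h : ∀ a, Commute Φ (ExteriorAlgebra.ι ℝ a)) (Ψ : Forms n) : Commute Φ Ψ := by
  induction Ψ using ExteriorAlgebra.induction with
  | algebraMap r => exact Algebra.commute_algebraMap_right r Φ
  | ι x => exact h x
  | mul a b ha hb => exact ha.mul_right hb
  | add a b ha hb => exact ha.add_right hb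

theorem commute_ι_mul_ι {n : ℕ} (a b : Covec n) (Ψ : Forms n) :
    Commute (ExteriorAlgebra.ι ℝ a * ExteriorAlgebra.ι ℝ b) Ψ := by
  refine commute_of_commute_ι (fun c => ?_) Ψ
  change _ * _ = _ * _
  rw [mul_assoc, ι_mul_ι_swap b c, mul_neg, ← mul_assoc, ι_mul_ι_swap a c]
  simp [mul_assoc]

theorem commute_hessForm {n : ℕ} (H : BilForm n) (Ψ : Forms n) : Commute (hessForm n H) Ψ := by
  rw [hessForm_apply]
  exact Commute.sum_left _ _ _ fun p _ => commute_ι_mul_ι _ _ _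

/-! ### Continuous and continuously differentiable form-valued functions -/

/-- A form-valued function that is a finite sum of constant forms with continuous coefficients. -/
def FormCont {n : ℕ} {X : Type*} [TopologicalSpace X] (Φ : X → Forms n) : Prop :=
  ∃ (κ : Type) (_ : Fintype κ) (c : κ → X → ℝ) (w : κ → Forms n),
    (∀ s, Continuous (c s)) ∧ ∀ x, Φ x = ∑ s, c s x • w s

namespace FormCont

variable {n : ℕ} {X : Type*} [TopologicalSpace X] {Φ Ψ : X → Forms n}

theorem const (w : Forms n) : FormCont (fun _ : X => w) :=
  ⟨Unit, inferInstance, fun _ _ => 1, fun _ => w, fun _ => continuous_const, fun _ => by simp⟩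

theorem mul (hΦ : FormCont Φ) (hΨ : FormCont Ψ) : FormCont fun x => Φ x * Ψ x := by
  obtain ⟨κ, _, c, w, hc, h⟩ := hΦ
  obtain ⟨κ', _, c', w', hc', h'⟩ := hΨ
  refine ⟨κ × κ', inferInstance, fun s x => c s.1 x * c' s.2 x, fun s => w s.1 * w' s.2,
    fun s => (hc _).mul (hc' _), fun x => ?_⟩
  beta_reduce
  rw [h, h', Finset.sum_mul_sum, Fintype.sum_prod_type]
  simp only [smul_mul_smul_comm]

theorem add (hΦ : FormCont Φ) (hΨ : FormCont Ψ) : FormCont fun x => Φ x + Ψ x := by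
  obtain ⟨κ, _, c, w, hc, h⟩ := hΦ
  obtain ⟨κ', _, c', w', hc', h'⟩ := hΨ
  refine ⟨κ ⊕ κ', inferInstance, Sum.elim c c', Sum.elim w w', fun s => ?_, fun x => ?_⟩
  · cases s
    · exact hc _
    · exact hc' _
  · simp [h, h']

theorem smul (hΦ : FormCont Φ) {r : X → ℝ} (hr : Continuous r) :
    FormCont fun x => r x • Φ x := by
  obtain ⟨κ, _, c, w, hc, h⟩ := hΦ
  exact ⟨κ, inferInstance, fun s x => r x * c s x, w, fun s => hr.mul (hc s),
    fun x => by simp [h, Finset.smul_sum, mul_smul]⟩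

theorem pow (hΦ : FormCont Φ) (k : ℕ) : FormCont fun x => Φ x ^ k := by
  induction k with
  | zero => simpa using const 1
  | succ k ih => simpa only [pow_succ] using ih.mul hΦ

theorem continuous (hΦ : FormCont Φ) (L : Forms n →ₗ[ℝ] ℝ) : Continuous fun x => L (Φ x) := by
  obtain ⟨κ, _, c, w, hc, h⟩ := hΦ
  simp only [h, map_sum, map_smul, smul_eq_mul]
  exact continuous_finsetSum _ fun s _ => (hc s).mul continuous_const

theorem hessForm {H : X → BilForm n} (hH : Continuous H) :
    FormCont fun x => hessForm n (H x) := by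
  refine ⟨(Fin n × Fin 2) × (Fin n × Fin 2), inferInstance,
    fun s x => H x (frame n s.1) (frame n s.2),
    fun s => ZeroMass.hessForm n ((coframe n s.1).smulRight (coframe n s.2)),
    fun s => by fun_prop, fun x => ?_⟩
  beta_reduce
  conv_lhs => rw [bilForm_eq_sum (H x)]
  simp only [map_sum, map_smul, Fintype.sum_prod_type]

end FormCont

/-- `Φ` is a finite sum of constant forms with `C¹` coefficients, and `Φ' p` is its derivative
in the direction of the `p`-th real coordinate. -/
def FormC1 {n : ℕ} (Φ : Aff n → Forms n) (Φ' : Fin n × Fin 2 → Aff n → Forms n) : Prop :=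
  ∃ (κ : Type) (_ : Fintype κ) (c : κ → Aff n → ℝ) (w : κ → Forms n),
    (∀ s, ContDiff ℝ 1 (c s)) ∧ (∀ ζ, Φ ζ = ∑ s, c s ζ • w s) ∧
      ∀ p ζ, Φ' p ζ = ∑ s, fderiv ℝ (c s) ζ (frame n p) • w s

namespace FormC1

variable {n : ℕ} {Φ Ψ : Aff n → Forms n} {Φ' Ψ' : Fin n × Fin 2 → Aff n → Forms n}

theorem const (w : Forms n) : FormC1 (fun _ : Aff n => w) fun _ _ => 0 :=
  ⟨Unit, inferInstance, fun _ _ => 1, fun _ => w, fun _ => contDiff_const, fun _ => by simp,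
    fun _ _ => by simp⟩

theorem mul (hΦ : FormC1 Φ Φ') (hΨ : FormC1 Ψ Ψ') :
    FormC1 (fun ζ => Φ ζ * Ψ ζ) fun p ζ => Φ' p ζ * Ψ ζ + Φ ζ * Ψ' p ζ := by
  obtain ⟨κ, _, c, w, hc, h, hd⟩ := hΦ
  obtain ⟨κ', _, c', w', hc', h', hd'⟩ := hΨ
  refine ⟨κ × κ', inferInstance, fun s ζ => c s.1 ζ * c' s.2 ζ, fun s => w s.1 * w' s.2,
    fun s => (hc _).mul (hc' _), fun x => ?_, fun p x => ?_⟩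
  · beta_reduce
    rw [h, h', Finset.sum_mul_sum, Fintype.sum_prod_type]
    simp only [smul_mul_smul_comm]
  · beta_reduce
    rw [h, h', hd, hd', Finset.sum_mul_sum, Finset.sum_mul_sum, Fintype.sum_prod_type,
      ← Finset.sum_add_distrib]
    refine Finset.sum_congr rfl fun s _ => ?_
    rw [← Finset.sum_add_distrib]
    refine Finset.sum_congr rfl fun s' _ => ?_
    rw [fderiv_fun_mul ((hc s).differentiable (by norm_num) x)
      ((hc' s').differentiable (by norm_num) x), smul_mul_smul_comm, smul_mul_smul_comm,
      ← add_smul]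
    congr 1
    simp only [add_apply, smul_apply, smul_eq_mul]
    ring

theorem ι_covec {α : Aff n → Covec n} (hα : ContDiff ℝ 1 α) :
    FormC1 (fun ζ => ExteriorAlgebra.ι ℝ (α ζ))
      fun p ζ => ExteriorAlgebra.ι ℝ (fderiv ℝ α ζ (frame n p)) := by
  refine ⟨Fin n × Fin 2, inferInstance, fun q ζ => α ζ (frame n q),
    fun q => ExteriorAlgebra.ι ℝ (coframe n q), fun q => hα.clm_apply contDiff_const,
    fun ζ => ?_, fun p ζ => ?_⟩
  · beta_reduce
    conv_lhs => rw [← sum_apply_frame_smul_coframe (α ζ)]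
    simp only [map_sum, map_smul]
  · beta_reduce
    conv_lhs => rw [← sum_apply_frame_smul_coframe (fderiv ℝ α ζ (frame n p))]
    simp only [map_sum, map_smul]
    refine Finset.sum_congr rfl fun q _ => ?_
    congr 1
    rw [fderiv_clm_apply (hα.differentiable (by norm_num) ζ) (differentiableAt_const _)]
    simp

theorem sum {κ : Type} [Fintype κ] {F : κ → Aff n → Forms n}
    {F' : κ → Fin n × Fin 2 → Aff n → Forms n} (h : ∀ s, FormC1 (F s) (F' s)) :
    FormC1 (fun ζ => ∑ s, F s ζ) fun p ζ => ∑ s, F' s p ζ := by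
  choose τ hτ c w hc h h' using h
  refine ⟨Σ s, τ s, inferInstance, fun s => c s.1 s.2, fun s => w s.1 s.2, fun s => hc _ _,
    fun ζ => ?_, fun p ζ => ?_⟩
  · simp only [h, Fintype.sum_sigma]
  · simp only [h', Fintype.sum_sigma]

theorem integral_deriv_eq_zero (hΦ : FormC1 Φ Φ') (hs : HasCompactSupport Φ)
    (L : Forms n →ₗ[ℝ] ℝ) (p : Fin n × Fin 2) :
    Integrable (fun ζ => L (Φ' p ζ)) ∧ ∫ ζ, L (Φ' p ζ) = 0 := by
  obtain ⟨κ, _, c, w, hc, h, hd⟩ := hΦ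
  set f : Aff n → ℝ := fun ζ => L (Φ ζ) with hf
  have hfe : f = fun ζ => ∑ s, c s ζ * L (w s) := by
    ext ζ
    simp [hf, h]
  have hf1 : ContDiff ℝ 1 f := by
    rw [hfe]
    exact ContDiff.sum fun s _ => (hc s).mul contDiff_const
  have hfd : ∀ ζ, L (Φ' p ζ) = fderiv ℝ f ζ (frame n p) := by
    intro ζ
    have : HasFDerivAt f (∑ s, L (w s) • fderiv ℝ (c s) ζ) ζ := by
      rw [hfe]
      exact HasFDerivAt.fun_sum fun s _ =>
        ((hc s).differentiable (by norm_num) ζ).hasFDerivAt.mul_const _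
    rw [this.fderiv, hd]
    simp [mul_comm]
  have hfs : HasCompactSupport f := hs.comp_left (g := L) (map_zero L)
  have hfi : Integrable f := hf1.continuous.integrable_of_hasCompactSupport hfs
  have hdi : Integrable fun ζ => fderiv ℝ f ζ (frame n p) := by
    refine Continuous.integrable_of_hasCompactSupport ?_ ?_
    · exact (hf1.continuous_fderiv (by norm_num)).clm_apply continuous_const
    · exact (hfs.fderiv ℝ).comp_left (g := fun l : Covec n => l (frame n p)) (by simp)
  simp only [hfd]
  refine ⟨hdi, ?_⟩
  -- Integration by parts against the constant function `1`.
  have := integral_mul_fderiv_eq_neg_fderiv_mul_of_integrable (μ := volume) (𝕜 := ℝ)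
    (f := fun _ : Aff n => (1 : ℝ)) (g := f) (v := frame n p) (by simp) (by simpa using hdi)
    (by simpa using hfi) (fun x _ => differentiableAt_const _)
    (fun x _ => hf1.differentiable (by norm_num) x)
  simpa using this

end FormC1

/-! ### Closed forms and Stokes' theorem. -/

/-- A closed form-valued function of class `C¹` with values in the centre of the exterior
algebra. -/
def IsClosedCentral {n : ℕ} (Φ : Aff n → Forms n) : Prop :=
  ∃ Φ' : Fin n × Fin 2 → Aff n → Forms n, FormC1 Φ Φ' ∧
    (∀ ζ, ∑ p, ExteriorAlgebra.ι ℝ (coframe n p) * Φ' p ζ = 0) ∧ ∀ ζ Ψ, Commute (Φ ζ) Ψ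

namespace IsClosedCentral

variable {n : ℕ} {Φ Ψ : Aff n → Forms n}

theorem one : IsClosedCentral (fun _ : Aff n => (1 : Forms n)) :=
  ⟨_, FormC1.const 1, fun _ => by simp, fun _ Ψ => Commute.one_left Ψ⟩

/-- Centrality lets `dx^p` pass through `Φ`, so the Leibniz rule for `d` holds without signs. -/
theorem mul (hΦ : IsClosedCentral Φ) (hΨ : IsClosedCentral Ψ) :
    IsClosedCentral fun ζ => Φ ζ * Ψ ζ := by
  obtain ⟨Φ', h, hd, hc⟩ := hΦ
  obtain ⟨Ψ', k, kd, kc⟩ := hΨ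
  refine ⟨_, h.mul k, fun ζ => ?_, fun ζ X => (hc ζ X).mul_left (kc ζ X)⟩
  have e (p) : ExteriorAlgebra.ι ℝ (coframe n p) * (Φ' p ζ * Ψ ζ + Φ ζ * Ψ' p ζ) =
      ExteriorAlgebra.ι ℝ (coframe n p) * Φ' p ζ * Ψ ζ +
        Φ ζ * (ExteriorAlgebra.ι ℝ (coframe n p) * Ψ' p ζ) := by
    rw [mul_add, ← mul_assoc, ← mul_assoc, ← mul_assoc, (hc ζ _).eq]
  simp only [e, Finset.sum_add_distrib, ← Finset.sum_mul, ← Finset.mul_sum, hd, kd]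
  simp

theorem pow (hΦ : IsClosedCentral Φ) (k : ℕ) : IsClosedCentral fun ζ => Φ ζ ^ k := by
  induction k with
  | zero => simpa using one
  | succ k ih => simpa only [pow_succ] using ih.mul hΦ

theorem extD {α : Aff n → Covec n} (hα : ContDiff ℝ 2 α) : IsClosedCentral (extD α) := by
  have h1 : ContDiff ℝ 1 (fderiv ℝ α) := hα.fderiv_right (by norm_num)
  have hp (p : Fin n × Fin 2) : ContDiff ℝ 1 fun ζ => fderiv ℝ α ζ (frame n p) :=
    h1.clm_apply contDiff_const
  refine ⟨_, FormC1.sum fun p => (FormC1.const (ExteriorAlgebra.ι ℝ (coframe n p))).mul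
    (FormC1.ι_covec (hp p)), fun ζ => ?_, fun ζ X =>
      Commute.sum_left _ _ _ fun p _ => commute_ι_mul_ι _ _ _⟩
  have hd (p q) : fderiv ℝ (fun ζ => fderiv ℝ α ζ (frame n p)) ζ (frame n q) =
      fderiv ℝ (fderiv ℝ α) ζ (frame n q) (frame n p) := by
    rw [fderiv_clm_apply (h1.differentiable (by norm_num) ζ) (differentiableAt_const _)]
    simp
  have hsymm (p q) : fderiv ℝ (fderiv ℝ α) ζ (frame n q) (frame n p) =
      fderiv ℝ (fderiv ℝ α) ζ (frame n p) (frame n q) :=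
    (hα.contDiffAt.isSymmSndFDerivAt (by simp)) _ _
  simp only [hd, zero_mul, zero_add, Finset.mul_sum]
  set S := ∑ q, ∑ p, ExteriorAlgebra.ι ℝ (coframe n q) * (ExteriorAlgebra.ι ℝ (coframe n p) *
    ExteriorAlgebra.ι ℝ (fderiv ℝ (fderiv ℝ α) ζ (frame n q) (frame n p))) with hS
  -- `d ∘ d = 0`: second derivatives are symmetric in the two coordinates, while `dx^q ∧ dx^p` is
  -- antisymmetric.
  have : S = -S := by
    conv_lhs => rw [hS, Finset.sum_comm]
    rw [hS, ← Finset.sum_neg_distrib]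
    refine Finset.sum_congr rfl fun q _ => ?_
    rw [← Finset.sum_neg_distrib]
    refine Finset.sum_congr rfl fun p _ => ?_
    rw [← mul_assoc, ι_mul_ι_swap, hsymm, neg_mul, mul_assoc]
  have h2 : (2 : ℝ) • S = 0 := by
    rw [two_smul]
    nth_rewrite 1 [this]
    exact neg_add_cancel S
  exact (smul_eq_zero.mp h2).resolve_left (by norm_num)

/-- **Stokes' theorem** for compactly supported primitives. -/
theorem integral_extD_mul_eq_zero (hΨ : IsClosedCentral Ψ) {α : Aff n → Covec n}
    (hα : ContDiff ℝ 1 α) (hs : HasCompactSupport α) (L : Forms n →ₗ[ℝ] ℝ) :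
    ∫ ζ, L (ZeroMass.extD α ζ * Ψ ζ) = 0 := by
  obtain ⟨Ψ', h, hd, -⟩ := hΨ
  have hs' : HasCompactSupport fun ζ => ExteriorAlgebra.ι ℝ (α ζ) * Ψ ζ := by
    refine hs.mono fun ζ hζ => ?_
    contrapose! hζ
    simp_all
  have key (p) := ((FormC1.ι_covec hα).mul h).integral_deriv_eq_zero hs'
    (L ∘ₗ LinearMap.mulLeft ℝ (ExteriorAlgebra.ι ℝ (coframe n p))) p
  have e (ζ) : L (ZeroMass.extD α ζ * Ψ ζ) =
      ∑ p, (L ∘ₗ LinearMap.mulLeft ℝ (ExteriorAlgebra.ι ℝ (coframe n p)))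
        (ExteriorAlgebra.ι ℝ (fderiv ℝ α ζ (frame n p)) * Ψ ζ +
          ExteriorAlgebra.ι ℝ (α ζ) * Ψ' p ζ) := by
    simp only [LinearMap.comp_apply, LinearMap.mulLeft_apply, ← map_sum]
    congr 1
    simp only [mul_add, Finset.sum_add_distrib, ZeroMass.extD, Finset.sum_mul, mul_assoc]
    -- The remaining sum is `-α ∧ dΨ`, which vanishes because `Ψ` is closed.
    rw [left_eq_add]
    simp only [← mul_assoc, ι_mul_ι_swap _ (α ζ)]
    simp only [neg_mul, mul_assoc, Finset.sum_neg_distrib, ← Finset.mul_sum, hd]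
    simp
  simp only [e]
  rw [integral_finsetSum _ fun p _ => (key p).1]
  exact Finset.sum_eq_zero fun p _ => (key p).2

end IsClosedCentral

theorem contDiff_dc {n : ℕ} {f : Aff n → ℝ} {k m : ℕ∞} (hf : ContDiff ℝ k f) (h : m + 1 ≤ k) :
    ContDiff ℝ m (dc f) :=
  ((hf.fderiv_right (by exact_mod_cast h)).clm_comp contDiff_const).const_smul _

theorem hasCompactSupport_dc {n : ℕ} {f : Aff n → ℝ} (hf : HasCompactSupport f) :
    HasCompactSupport (dc f) :=
  (hf.fderiv ℝ).comp_left (g := fun l : Covec n => (-(1 / 2) : ℝ) • l.comp (mulI n)) (by simp)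

theorem isClosedCentral_ddc {n : ℕ} {f : Aff n → ℝ} (hf : ContDiff ℝ 3 f) :
    IsClosedCentral (ddc f) :=
  IsClosedCentral.extD (contDiff_dc (k := 3) (m := 2) hf (by norm_num))

/-! ### Mollification -/

section Mollification

open Filter Topology ContinuousLinearMap

theorem exists_contDiffBump_seq {E : Type*} [NormedAddCommGroup E] :
    ∃ φ : ℕ → ContDiffBump (0 : E),
    Tendsto (fun k => (φ k).rOut) atTop (𝓝 0) ∧ ∀ k, (φ k).rOut ≤ 1 := by
  refine ⟨fun k =>
    { rIn := 1 / ((k + 1 : ℕ) + 1 : ℝ)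
      rOut := 1 / (k + 1 : ℝ)
      rIn_pos := by positivity
      rIn_lt_rOut := by
        rw [one_div_lt_one_div (by positivity) (by positivity)]
        push_cast
        linarith }, tendsto_one_div_add_atTop_nhds_zero_nat, fun k => ?_⟩
  change 1 / (k + 1 : ℝ) ≤ 1
  rw [div_le_one (by positivity)]
  linarith [(Nat.cast_nonneg k : (0 : ℝ) ≤ k)]

/-- Dominated convergence: the integrands vanish off `K` and are bounded by the maximum of `|P|` on
`Q × K`. -/
theorem tendsto_integral_comp {E V : Type*} [TopologicalSpace V] [NormedAddCommGroup E]
    [MeasurableSpace E] [BorelSpace E]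
    {μ : Measure E} [IsFiniteMeasureOnCompacts μ] {P : V × E → ℝ} (hP : Continuous P)
    {D : ℕ → E → V} {D' : E → V} (hD : ∀ k, Continuous (D k))
    {K : Set E} {Q : Set V} (hK : IsCompact K) (hQ : IsCompact Q) (hDQ : ∀ k x, D k x ∈ Q)
    (h0 : ∀ k, ∀ x ∉ K, P (D k x, x) = 0)
    (hlim : ∀ x, Tendsto (fun k => D k x) atTop (𝓝 (D' x))) :
    Tendsto (fun k => ∫ x, P (D k x, x) ∂μ) atTop (𝓝 (∫ x, P (D' x, x) ∂μ)) := by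
  obtain ⟨M, hM⟩ := (hQ.prod hK).exists_bound_of_continuousOn hP.continuousOn
  refine tendsto_integral_of_dominated_convergence (K.indicator fun _ => M)
    (fun k => (hP.comp ((hD k).prodMk continuous_id)).aestronglyMeasurable)
    ((integrable_indicator_iff hK.measurableSet).mpr (integrableOn_const hK.measure_lt_top.ne))
    (fun k => Eventually.of_forall fun x => ?_)
    (Eventually.of_forall fun x => (hP.tendsto _).comp ((hlim x).prodMk_nhds tendsto_const_nhds))
  by_cases hx : x ∈ K
  · rw [indicator_of_mem hx]
    exact hM _ ⟨hDQ k x, hx⟩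
  · simp [hx, h0 k x hx]

variable {E F : Type*} [NormedAddCommGroup E] [NormedSpace ℝ E] [FiniteDimensional ℝ E]
  [MeasurableSpace E] [BorelSpace E]
  [NormedAddCommGroup F] [NormedSpace ℝ F]

/-- The convolution with a normalized bump function. -/
def mollify (φ : ContDiffBump (0 : E)) (μ : Measure E) (g : E → F) : E → F :=
  convolution (φ.normed μ) g (lsmul ℝ ℝ) μ

theorem fderiv_mollify (μ : Measure E) [μ.IsAddHaarMeasure] (φ : ContDiffBump (0 : E))
    {g : E → F} (hg : ContDiff ℝ 1 g)
    (hs : HasCompactSupport g) : fderiv ℝ (mollify φ μ g) = mollify φ μ (fderiv ℝ g) := by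
  ext1 x
  exact (hs.hasFDerivAt_convolution_right (lsmul ℝ ℝ)
    φ.continuous_normed.locallyIntegrable hg x).fderiv

theorem norm_mollify_le (μ : Measure E) [μ.IsAddHaarMeasure] (φ : ContDiffBump (0 : E))
    {g : E → F} {C : ℝ} (hC : ∀ x, ‖g x‖ ≤ C)
    (x : E) : ‖mollify φ μ g x‖ ≤ C := by
  rw [mollify, convolution_lsmul]
  calc ‖∫ t, φ.normed μ t • g (x - t) ∂μ‖
      ≤ ∫ t, φ.normed μ t * C ∂μ := by
        refine norm_integral_le_of_norm_le (φ.integrable_normed.mul_const C)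
          (Eventually.of_forall fun t => ?_)
        rw [norm_smul, Real.norm_of_nonneg (φ.nonneg_normed t)]
        exact mul_le_mul_of_nonneg_left (hC _) (φ.nonneg_normed t)
    _ = C := by rw [integral_mul_const, φ.integral_normed, one_mul]

theorem mollify_eq_zero (μ : Measure E) [μ.IsAddHaarMeasure] (φ : ContDiffBump (0 : E))
    (hφ : φ.rOut ≤ 1) {g : E → F} {x : E}
    (hx : x ∉ Metric.cthickening 1 (tsupport g)) : mollify φ μ g x = 0 := by
  rw [mollify, convolution_lsmul]
  refine integral_eq_zero_of_ae (Eventually.of_forall fun t => ?_)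
  by_cases ht : φ.normed μ t = 0
  · simp [ht]
  · have ht' : t ∈ Metric.ball (0 : E) φ.rOut := by
      rw [← φ.support_normed_eq (μ := μ)]
      exact ht
    have : g (x - t) = 0 := by
      refine image_eq_zero_of_notMem_tsupport fun hmem => hx ?_
      refine Metric.mem_cthickening_of_dist_le x (x - t) 1 _ hmem ?_
      rw [mem_ball_zero_iff] at ht'
      simpa [dist_eq_norm] using ht'.le.trans hφ
    simp [this]

theorem tendsto_mollify (μ : Measure E) [μ.IsAddHaarMeasure] [CompleteSpace F]
    {φ : ℕ → ContDiffBump (0 : E)}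
    (hφ : Tendsto (fun k => (φ k).rOut) atTop (𝓝 0)) {g : E → F} (hg : Continuous g) (x : E) :
    Tendsto (fun k => mollify (φ k) μ g x) atTop (𝓝 (g x)) :=
  ContDiffBump.convolution_tendsto_right_of_continuous hφ hg x

theorem exists_bound_fderiv_mollify [CompleteSpace F] (μ : Measure E) [μ.IsAddHaarMeasure]
    {g : E → F} (hg : ContDiff ℝ 1 g) (hs : HasCompactSupport g) {φ : ℕ → ContDiffBump (0 : E)}
    (hφ : Tendsto (fun k => (φ k).rOut) atTop (𝓝 0)) (hφ1 : ∀ k, (φ k).rOut ≤ 1) :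
    ∃ (K : Set E) (C : ℝ), IsCompact K ∧ (∀ k x, ‖fderiv ℝ (mollify (φ k) μ g) x‖ ≤ C) ∧
      (∀ k, ∀ x ∉ K, fderiv ℝ (mollify (φ k) μ g) x = 0) ∧
      ∀ x, Tendsto (fun k => fderiv ℝ (mollify (φ k) μ g) x) atTop (𝓝 (fderiv ℝ g x)) := by
  have h2 : Continuous (fderiv ℝ g) := hg.continuous_fderiv (by norm_num)
  have hs2 : HasCompactSupport (fderiv ℝ g) := hs.fderiv ℝ
  obtain ⟨C, hC⟩ := h2.bounded_above_of_compact_support hs2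
  refine ⟨Metric.cthickening 1 (tsupport (fderiv ℝ g)), C, hs2.isCompact.cthickening,
    fun k x => ?_, fun k x hx => ?_, fun x => ?_⟩
  · rw [fderiv_mollify μ (φ k) hg hs]
    exact norm_mollify_le μ (φ k) hC x
  · rw [fderiv_mollify μ (φ k) hg hs]
    exact mollify_eq_zero μ (φ k) (hφ1 k) hx
  · simp only [fderiv_mollify μ _ hg hs]
    exact tendsto_mollify μ hφ h2 x

/-- Derivatives commute with convolution, so the Hessians of the mollified functions are mollified
Hessians: the bound for `g` persists, the supports stay within distance `1` of the original one, and
pointwise convergence follows from continuity. -/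
theorem exists_mollification (μ : Measure E) [μ.IsAddHaarMeasure] {g : E → ℝ}
    (hg : ContDiff ℝ 2 g) (hs : HasCompactSupport g) :
    ∃ (G : ℕ → E → ℝ) (K : Set E) (C : ℝ), IsCompact K ∧ (∀ k, ContDiff ℝ 3 (G k)) ∧
      (∀ k, HasCompactSupport (G k)) ∧ (∀ k x, ‖fderiv ℝ (fderiv ℝ (G k)) x‖ ≤ C) ∧
      (∀ k, ∀ x ∉ K, fderiv ℝ (fderiv ℝ (G k)) x = 0) ∧
      ∀ x, Tendsto (fun k => fderiv ℝ (fderiv ℝ (G k)) x) atTop (𝓝 (fderiv ℝ (fderiv ℝ g) x)) := by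
  obtain ⟨φ, hφ, hφ1⟩ := exists_contDiffBump_seq (E := E)
  obtain ⟨K, C, h⟩ := exists_bound_fderiv_mollify μ (hg.fderiv_right (m := 1) (by norm_num))
    (hs.fderiv ℝ) hφ hφ1
  simp only [← fderiv_mollify μ _ (hg.of_le (by norm_num : (1 : WithTop ℕ∞) ≤ 2)) hs] at h
  exact ⟨fun k => mollify (φ k) μ g, K, C, h.1,
    fun k => (φ k).hasCompactSupport_normed.contDiff_convolution_left _ (n := 3)
      (φ k).contDiff_normed hg.continuous.locallyIntegrable,
    fun k => HasCompactSupport.convolution _ (φ k).hasCompactSupport_normed hs, h.2⟩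

end Mollification

/-! ### Vanishing integrals of exact forms with `C²` potentials. -/

theorem isSymm_hessian {n : ℕ} {f : Aff n → ℝ} (hf : ContDiff ℝ 2 f) (ζ v w : Aff n) :
    fderiv ℝ (fderiv ℝ f) ζ v w = fderiv ℝ (fderiv ℝ f) ζ w v :=
  (hf.contDiffAt.isSymmSndFDerivAt (by simp)) v w

theorem continuous_hessian {n : ℕ} {f : Aff n → ℝ} (hf : ContDiff ℝ 2 f) :
    Continuous (fderiv ℝ (fderiv ℝ f)) :=
  (hf.fderiv_right (m := 1) (by norm_num)).continuous_fderiv (by norm_num)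

theorem formCont_ddc {n : ℕ} {f : Aff n → ℝ} (hf : ContDiff ℝ 2 f) : FormCont (ddc f) := by
  simpa only [← ddc_eq_hessForm hf] using FormCont.hessForm (continuous_hessian hf)

theorem exists_isCompact_of_norm_le (V : Type*) [NormedAddCommGroup V] [ProperSpace V] (C : ℝ) :
    ∃ Q : Set V, IsCompact Q ∧ ∀ v, ‖v‖ ≤ C → v ∈ Q :=
  ⟨Metric.closedBall 0 C, isCompact_closedBall 0 C, fun v hv => by simpa using hv⟩

-- Closedness of `dd^c G` costs a third derivative, whereas `g` has only two. An integral identity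
-- that involves the Hessian alone passes from `C³` potentials to `C²` ones by mollification.
open Filter Topology in
theorem integral_comp_hessian_eq_zero {n : ℕ} {g : Aff n → ℝ} (hg : ContDiff ℝ 2 g)
    (hs : HasCompactSupport g) {P : BilForm n × Aff n → ℝ} (hP : Continuous P)
    (hP0 : ∀ ζ, P (0, ζ) = 0)
    (h : ∀ G : Aff n → ℝ, ContDiff ℝ 3 G → HasCompactSupport G →
      ∫ ζ, P (fderiv ℝ (fderiv ℝ G) ζ, ζ) = 0) :
    Integrable (fun ζ => P (fderiv ℝ (fderiv ℝ g) ζ, ζ)) ∧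
      ∫ ζ, P (fderiv ℝ (fderiv ℝ g) ζ, ζ) = 0 := by
  obtain ⟨G, K, C, hK, hG, hGs, hGC, hGK, hGt⟩ := exists_mollification volume hg hs
  have hcont {f : Aff n → ℝ} (hf : ContDiff ℝ 2 f) :
      Continuous fun ζ => P (fderiv ℝ (fderiv ℝ f) ζ, ζ) :=
    hP.comp ((continuous_hessian hf).prodMk continuous_id)
  constructor
  · refine (hcont hg).integrable_of_hasCompactSupport ?_
    refine ((hs.fderiv ℝ).fderiv ℝ).mono fun ζ hζ => ?_
    contrapose! hζ
    simp only [Function.mem_support, not_not] at hζ ⊢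
    rw [hζ, hP0]
  · have hGc (k) : Continuous (fderiv ℝ (fderiv ℝ (G k))) :=
      continuous_hessian ((hG k).of_le (by norm_num))
    have : ProperSpace (BilForm n) := FiniteDimensional.proper ℝ (BilForm n)
    obtain ⟨Q, hQ, hQC⟩ := exists_isCompact_of_norm_le (BilForm n) C
    have hGQ (k ζ) : fderiv ℝ (fderiv ℝ (G k)) ζ ∈ Q := hQC _ (hGC k ζ)
    have hlim := tendsto_integral_comp (V := BilForm n) (μ := volume)
      (D := fun k => fderiv ℝ (fderiv ℝ (G k)))
      (D' := fderiv ℝ (fderiv ℝ g)) hP hGc hK hQ hGQ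
      (fun k x hx => by rw [hGK k x hx, hP0]) hGt
    refine tendsto_nhds_unique hlim ?_
    simp only [fun k => h (G k) (hG k) (hGs k)]
    exact tendsto_const_nhds

/-- For `g` of class `C³`, one factor `dd^c g` is the differential of the compactly supported `d^c
g` and the other factors are closed, so Stokes' theorem applies. -/
theorem integral_ddc_pow_mul_eq_zero {n : ℕ} {g f : Aff n → ℝ} (hg : ContDiff ℝ 2 g)
    (hs : HasCompactSupport g) (hf : ContDiff ℝ 3 f) (i j : ℕ) (L : Forms n →ₗ[ℝ] ℝ) :
    Integrable (fun ζ => L (ddc g ζ ^ (j + 1) * ddc f ζ ^ i)) ∧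
      ∫ ζ, L (ddc g ζ ^ (j + 1) * ddc f ζ ^ i) = 0 := by
  have hf2 : ContDiff ℝ 2 f := hf.of_le (by norm_num)
  have hc : FormCont fun x : BilForm n × Aff n => ddc f x.2 := by
    have hcc : Continuous fun x : BilForm n × Aff n => fderiv ℝ (fderiv ℝ f) x.2 :=
      (continuous_hessian hf2).comp continuous_snd
    simpa only [← ddc_eq_hessForm hf2] using FormCont.hessForm hcc
  have hfst : FormCont fun x : BilForm n × Aff n => hessForm n x.1 :=
    FormCont.hessForm continuous_fst
  have key := integral_comp_hessian_eq_zero hg hs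
    (((hfst.pow (j + 1)).mul (hc.pow i)).continuous L) (by simp) fun G hG hGs => by
      simp only [← ddc_eq_hessForm (hG.of_le (by norm_num : (2 : WithTop ℕ∞) ≤ 3)), pow_succ',
        mul_assoc]
      exact (((isClosedCentral_ddc hG).pow j).mul
        ((isClosedCentral_ddc hf).pow i)).integral_extD_mul_eq_zero
          (contDiff_dc (k := 3) (m := 1) hG (by norm_num)) (hasCompactSupport_dc hGs) L
  simpa only [← ddc_eq_hessForm hg] using key

/-! ### The Fubini–Study form -/

/-- By polarization the Levi form determines the `J`-average of a symmetric form, and `hessForm`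
sees only that average. -/
theorem hessForm_congr {n : ℕ} {H K : BilForm n} (hH : ∀ v w, H v w = H w v)
    (hK : ∀ v w, K v w = K w v) (h : ∀ v, levi H v = levi K v) : hessForm n H = hessForm n K := by
  have key : H + conjForm H = K + conjForm K := by
    ext v w
    have h1 := h (v + w)
    have h2 := h v
    have h3 := h w
    simp only [levi, map_add, add_apply] at h1 h2 h3
    simp only [add_apply, conjForm_apply]
    linarith [hH v w, hK v w, hH (mulI n v) (mulI n w), hK (mulI n v) (mulI n w)]
  have := congrArg (hessForm n) key
  rw [map_add, map_add, hessForm_conjForm H hH, hessForm_conjForm K hK, ← two_smul ℝ,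
    ← two_smul ℝ (hessForm n K)] at this
  exact smul_right_injective _ (by norm_num : (2 : ℝ) ≠ 0) this

/-- The potential `(1/2) log (1 + |ζ|²)` of the Fubini–Study form. -/
def fsPot {n : ℕ} (ζ : Aff n) : ℝ := (1 / 2) * Real.log (1 + ∑ a, ‖ζ a‖ ^ 2)

/-- The real inner product of `ℂⁿ`. -/
def realInner (n : ℕ) : BilForm n := ∑ p, (coframe n p).smulRight (coframe n p)

theorem realInner_apply {n : ℕ} (v w : Aff n) :
    realInner n v w = ∑ a, ((v a).re * (w a).re + (v a).im * (w a).im) := by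
  simp [realInner, sum_apply, Fintype.sum_prod_type, coframe]

theorem realInner_comm {n : ℕ} (v w : Aff n) : realInner n v w = realInner n w v := by
  simp only [realInner_apply, mul_comm]

theorem realInner_self {n : ℕ} (v : Aff n) : realInner n v v = ∑ a, ‖v a‖ ^ 2 := by
  rw [realInner_apply]
  refine Finset.sum_congr rfl fun a _ => ?_
  rw [← Complex.normSq_eq_norm_sq, Complex.normSq_apply]

theorem one_add_sum_pos {n : ℕ} (ζ : Aff n) : 0 < 1 + ∑ a, ‖ζ a‖ ^ 2 := by positivity

theorem contDiff_sum_norm_sq {n : ℕ} {k : WithTop ℕ∞} :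
    ContDiff ℝ k fun ζ : Aff n => 1 + ∑ a, ‖ζ a‖ ^ 2 := by
  simp only [← realInner_self]
  exact contDiff_const.add ((realInner n).contDiff.clm_apply contDiff_id)

theorem contDiff_fsPot {n : ℕ} {k : WithTop ℕ∞} : ContDiff ℝ k (fsPot (n := n)) :=
  contDiff_const.mul (contDiff_sum_norm_sq.log fun ζ => (one_add_sum_pos ζ).ne')

theorem hasFDerivAt_sum_norm_sq {n : ℕ} (ζ : Aff n) :
    HasFDerivAt (fun ζ : Aff n => 1 + ∑ a, ‖ζ a‖ ^ 2) ((2 : ℝ) • realInner n ζ) ζ := by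
  simp only [← realInner_self]
  have h := (((realInner n).hasFDerivAt (x := ζ)).clm_apply (hasFDerivAt_id ζ)).const_add (1 : ℝ)
  refine h.congr_fderiv ?_
  ext v
  simp [realInner_comm v, two_mul]

theorem fderiv_fsPot {n : ℕ} :
    fderiv ℝ (fsPot (n := n)) = fun ζ => (1 + ∑ a, ‖ζ a‖ ^ 2)⁻¹ • realInner n ζ := by
  ext1 ζ
  have h := ((hasFDerivAt_sum_norm_sq ζ).log (one_add_sum_pos ζ).ne').const_mul (1 / 2 : ℝ)
  have h' : HasFDerivAt (fsPot (n := n)) _ ζ := h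
  rw [h'.fderiv, smul_smul, smul_smul]
  congr 1
  ring

theorem hessian_fsPot {n : ℕ} (ζ v w : Aff n) :
    fderiv ℝ (fderiv ℝ fsPot) ζ v w = (1 + ∑ a, ‖ζ a‖ ^ 2)⁻¹ * realInner n v w -
      2 * ((1 + ∑ a, ‖ζ a‖ ^ 2) ^ 2)⁻¹ * realInner n ζ v * realInner n ζ w := by
  rw [fderiv_fsPot]
  have h := ((hasDerivAt_inv (one_add_sum_pos ζ).ne').comp_hasFDerivAt ζ
    (hasFDerivAt_sum_norm_sq ζ)).smul ((realInner n).hasFDerivAt (x := ζ))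
  rw [HasFDerivAt.fderiv (f := fun ζ => (1 + ∑ a, ‖ζ a‖ ^ 2)⁻¹ • realInner n ζ) h]
  simp
  ring

theorem omegaFS_eq_hessForm {n : ℕ} (ζ : Aff n) :
    omegaFS ζ = hessForm n (fderiv ℝ (fderiv ℝ fsPot) ζ) := by
  have hl : ContDiff ℝ 2 fun ξ : Aff n => Real.log (1 + ∑ a, ‖ξ a‖ ^ 2) :=
    contDiff_sum_norm_sq.log fun ζ => (one_add_sum_pos ζ).ne'
  have h1 : ∀ ξ : Aff n, fderiv ℝ fsPot ξ =
      (1 / 2 : ℝ) • fderiv ℝ (fun ξ : Aff n => Real.log (1 + ∑ a, ‖ξ a‖ ^ 2)) ξ := fun ξ =>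
    fderiv_const_mul (hl.differentiable (by norm_num) ξ) _
  have h2 : fderiv ℝ (fderiv ℝ fsPot) ζ =
      (1 / 2 : ℝ) • fderiv ℝ (fderiv ℝ (fun ξ : Aff n => Real.log (1 + ∑ a, ‖ξ a‖ ^ 2))) ζ := by
    rw [funext h1]
    exact fderiv_fun_const_smul
      ((hl.fderiv_right (m := 1) (by norm_num)).differentiable (by norm_num) ζ) _
  rw [omegaFS, ddc_eq_hessForm hl, h2, map_smul]

theorem omegaFS_eq_ddc {n : ℕ} : omegaFS = ddc (fsPot (n := n)) := by
  ext1 ζ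
  rw [omegaFS_eq_hessForm, ddc_eq_hessForm contDiff_fsPot]

/-- A matrix `B` with `B* B = s⁻¹ (1 - s⁻¹ ζ̄ ζᵀ)` (up to conjugation), where `s = 1 + |ζ|²`. -/
def fsRoot {n : ℕ} (ζ : Aff n) : Matrix (Fin n) (Fin n) ℂ :=
  let s : ℝ := 1 + ∑ a, ‖ζ a‖ ^ 2
  ((√s)⁻¹ : ℂ) • (1 - ((s + √s : ℝ)⁻¹ : ℂ) • Matrix.vecMulVec ζ (star ζ))

theorem normSq_det_fsRoot {n : ℕ} (ζ : Aff n) :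
    Complex.normSq (fsRoot ζ).det = ((1 + ∑ a, ‖ζ a‖ ^ 2) ^ (n + 1))⁻¹ := by
  set s : ℝ := 1 + ∑ a, ‖ζ a‖ ^ 2 with hs
  have hs0 : 0 < s := one_add_sum_pos ζ
  have hr : 0 < √s := Real.sqrt_pos.mpr hs0
  have hrs : √s * √s = s := Real.mul_self_sqrt hs0.le
  have hdet : (1 - ((s + √s : ℝ)⁻¹ : ℂ) • Matrix.vecMulVec ζ (star ζ)).det =
      (((√s)⁻¹ : ℝ) : ℂ) := by
    rw [Matrix.vecMulVec_eq Unit, ← Matrix.smul_mul, Matrix.det_one_sub_mul_comm, Matrix.det_unique]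
    have hdot : ∑ a, (starRingEnd ℂ) (ζ a) * ζ a = ((s - 1 : ℝ) : ℂ) := by
      rw [hs, add_sub_cancel_left, Complex.ofReal_sum]
      refine Finset.sum_congr rfl fun a _ => ?_
      rw [mul_comm, Complex.mul_conj, Complex.normSq_eq_norm_sq]
    -- The determinant of the rank one perturbation, with `|ζ|² = s - 1`. Together with the scalar
    -- `(√s)⁻¹` in each of the `n` rows this gives `|det|² = s^(-(n+1))`.
    have e : (1 : ℝ) - (s + √s)⁻¹ * (s - 1) = (√s)⁻¹ := by
      field_simp
      linear_combination hrs
    rw [← e]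
    simp only [Matrix.sub_apply, Matrix.one_apply_eq, Matrix.mul_apply, Matrix.smul_apply,
      Matrix.replicateRow_apply, Matrix.replicateCol_apply, Pi.star_apply, RCLike.star_def,
      smul_eq_mul, mul_left_comm _ (((s + √s : ℝ) : ℂ))⁻¹, ← Finset.mul_sum, hdot]
    push_cast
    rfl
  simp only [fsRoot, ← hs]
  rw [Matrix.det_smul, hdet, Fintype.card_fin, map_mul, map_pow, ← Complex.ofReal_inv,
    Complex.normSq_ofReal, ← mul_inv, hrs, inv_pow, ← mul_inv, pow_succ]

theorem sum_normSq_fsRoot {n : ℕ} (ζ v : Aff n) :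
    2 * ∑ k, Complex.normSq ((fsRoot ζ).mulVec v k) = levi (fderiv ℝ (fderiv ℝ fsPot) ζ) v := by
  set s : ℝ := 1 + ∑ a, ‖ζ a‖ ^ 2 with hs
  have hs0 : 0 < s := one_add_sum_pos ζ
  have hr : 0 < √s := Real.sqrt_pos.mpr hs0
  have hrs : √s * √s = s := Real.mul_self_sqrt hs0.le
  set c : ℝ := (s + √s)⁻¹ with hc
  set h : ℂ := ∑ a, (starRingEnd ℂ) (ζ a) * v a with hh
  have hB (k) : (fsRoot ζ).mulVec v k = ((√s)⁻¹ : ℝ) * (v k - (c : ℂ) * h * ζ k) := by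
    simp only [fsRoot, ← hs, Matrix.smul_mulVec, Matrix.sub_mulVec, Matrix.one_mulVec,
      Matrix.vecMulVec_mulVec, Pi.smul_apply, Pi.sub_apply, smul_eq_mul, dotProduct, Pi.star_apply,
      RCLike.star_def, ← hh, hc, MulOpposite.smul_eq_mul_unop, MulOpposite.unop_op]
    push_cast
    ring
  have hN (k) : Complex.normSq ((fsRoot ζ).mulVec v k) = s⁻¹ * (‖v k‖ ^ 2 +
      c ^ 2 * Complex.normSq h * ‖ζ k‖ ^ 2 -
        2 * c * ((starRingEnd ℂ) (ζ k) * v k * (starRingEnd ℂ) h).re) := by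
    rw [hB, map_mul, Complex.normSq_ofReal, ← mul_inv, hrs, Complex.normSq_sub, map_mul, map_mul,
      Complex.normSq_ofReal, Complex.normSq_eq_norm_sq (v k), Complex.normSq_eq_norm_sq (ζ k)]
    have : (v k * (starRingEnd ℂ) ((c : ℂ) * h * ζ k)) =
        (c : ℂ) * ((starRingEnd ℂ) (ζ k) * v k * (starRingEnd ℂ) h) := by
      simp only [map_mul, Complex.conj_ofReal]
      ring
    rw [this, Complex.re_ofReal_mul]
    ring
  have hsum : ∑ k, ((starRingEnd ℂ) (ζ k) * v k * (starRingEnd ℂ) h).re = Complex.normSq h := by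
    rw [← Complex.re_sum, ← Finset.sum_mul, ← hh, Complex.mul_conj, Complex.ofReal_re]
  have h1 : realInner n ζ v = h.re := by
    rw [realInner_apply, hh, Complex.re_sum]
    simp
  have h2 : realInner n ζ (mulI n v) = -h.im := by
    rw [realInner_apply, hh, Complex.im_sum, ← Finset.sum_neg_distrib]
    refine Finset.sum_congr rfl fun a _ => ?_
    simp
    ring
  have h3 : ∑ a, ‖mulI n v a‖ ^ 2 = ∑ a, ‖v a‖ ^ 2 := by simp
  have h4 : ∑ a, ‖ζ a‖ ^ 2 = s - 1 := by rw [hs]; ring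
  -- The equation that dictates the coefficient `(s + √s)⁻¹` in `fsRoot`.
  have hc' : c ^ 2 * (s - 1) - 2 * c = -s⁻¹ := by
    have gen : ∀ r : ℝ, 0 < r →
        ((r * r + r)⁻¹) ^ 2 * (r * r - 1) - 2 * (r * r + r)⁻¹ = -(r * r)⁻¹ := by
      intro r hr
      field_simp
      ring
    have := gen (√s) hr
    rwa [hrs] at this
  simp only [levi, hessian_fsPot, ← hs, h1, h2, realInner_self, h3, hN]
  rw [← Finset.mul_sum, Finset.sum_sub_distrib, Finset.sum_add_distrib, ← Finset.mul_sum,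
    ← Finset.mul_sum, hsum, h4, Complex.normSq_apply]
  rw [pow_two s, mul_inv]
  linear_combination 2 * s⁻¹ * (h.re * h.re + h.im * h.im) * hc'

/-- The real part of the `k`-th row of a complex matrix. -/
def reRow {n : ℕ} (B : Matrix (Fin n) (Fin n) ℂ) (k : Fin n) : Covec n :=
  Complex.reCLM.comp ((LinearMap.toContinuousLinearMap
    ((LinearMap.proj k ∘ₗ Matrix.toLin' B).restrictScalars ℝ)))

theorem reRow_apply {n : ℕ} (B : Matrix (Fin n) (Fin n) ℂ) (k : Fin n) (v : Aff n) :
    reRow B k v = (B.mulVec v k).re := rfl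

theorem reRow_mulI {n : ℕ} (B : Matrix (Fin n) (Fin n) ℂ) (k : Fin n) (v : Aff n) :
    reRow B k (mulI n v) = -(B.mulVec v k).im := by
  rw [reRow_apply, mulI_apply, Matrix.mulVec_smul]
  simp

theorem complexRows_reRow {n : ℕ} (B : Matrix (Fin n) (Fin n) ℂ) (ρ : Fin n → Fin n) :
    complexRows (fun i => reRow B (ρ i)) = Matrix.toLin' (B.submatrix ρ id) := by
  refine LinearMap.ext fun v => funext fun i => ?_
  change ((reRow B (ρ i) v : ℝ) : ℂ) - Complex.I * (reRow B (ρ i) (mulI n v) : ℝ) = _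
  rw [reRow_mulI, reRow_apply, Matrix.toLin'_apply]
  change _ = B.mulVec v (ρ i)
  conv_rhs => rw [← Complex.re_add_im (B.mulVec v (ρ i))]
  push_cast
  ring

theorem levi_hessian_fsPot_nonneg {n : ℕ} (ζ v : Aff n) :
    0 ≤ levi (fderiv ℝ (fderiv ℝ fsPot) ζ) v := by
  rw [← sum_normSq_fsRoot]
  exact mul_nonneg zero_le_two (Finset.sum_nonneg fun _ _ => Complex.normSq_nonneg _)

theorem posForm_omegaFS {n : ℕ} (ζ : Aff n) : PosForm (omegaFS ζ) := by
  rw [omegaFS_eq_hessForm]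
  exact posForm_hessForm _ (isSymm_hessian contDiff_fsPot ζ) (levi_hessian_fsPot_nonneg ζ)

theorem omegaFS_eq_sum {n : ℕ} (ζ : Aff n) :
    omegaFS ζ = ∑ k, elemForm (reRow (fsRoot ζ) k) := by
  have h : hessForm n ((2 : ℝ) • ∑ k, (reRow (fsRoot ζ) k).smulRight (reRow (fsRoot ζ) k)) =
      ∑ k, elemForm (reRow (fsRoot ζ) k) := by
    rw [map_smul, map_sum, Finset.smul_sum]
    refine Finset.sum_congr rfl fun k _ => ?_
    rw [hessForm_smulRight_self, smul_smul]
    norm_num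
  rw [omegaFS_eq_hessForm, ← h]
  refine hessForm_congr (isSymm_hessian contDiff_fsPot ζ) (fun v w => ?_) fun v => ?_
  · simp [sum_apply, mul_comm]
  · rw [← sum_normSq_fsRoot]
    simp only [levi, smul_apply, sum_apply, ContinuousLinearMap.smulRight_apply, smul_eq_mul,
      reRow_mulI]
    simp only [reRow_apply, Complex.normSq_apply]
    rw [← mul_add, ← Finset.sum_add_distrib]
    congr 1
    refine Finset.sum_congr rfl fun k _ => ?_
    ring

theorem pow_sum_eq {A κ : Type*} [Ring A] [Fintype κ] (x : κ → A) (m : ℕ) :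
    (∑ k, x k) ^ m = ∑ ρ : Fin m → κ, (List.ofFn fun i => x (ρ i)).prod := by
  classical
  have := (MultilinearMap.mkPiAlgebraFin ℤ m A).map_sum (fun _ : Fin m => x)
  simpa using this

/-- Expanding the power of the sum of elementary forms, each selection `ρ` of rows contributes
`|det|²` of a row selection matrix times `|det (fsRoot ζ)|²`. The value of `c` is irrelevant: only
the decay in `ζ` is needed. -/
theorem topCoeff_omegaFS_pow (n : ℕ) : ∃ c : ℝ, ∀ ζ : Aff n,
    topCoeff n (omegaFS ζ ^ n) = c * ((1 + ∑ a, ‖ζ a‖ ^ 2) ^ (n + 1))⁻¹ := by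
  refine ⟨∑ ρ : Fin n → Fin n,
    Complex.normSq ((1 : Matrix (Fin n) (Fin n) ℂ).submatrix ρ id).det, fun ζ => ?_⟩
  rw [omegaFS_eq_sum, pow_sum_eq, map_sum, Finset.sum_mul]
  refine Finset.sum_congr rfl fun ρ _ => ?_
  rw [topCoeff_prod_elemForm, complexRows_reRow, LinearMap.det_toLin', ← normSq_det_fsRoot,
    ← map_mul, ← Matrix.det_mul]
  congr 3
  ext i j
  simp [Matrix.mul_apply, Matrix.one_apply]

theorem continuous_topCoeff_omegaFS_pow (n : ℕ) :
    Continuous fun ζ : Aff n => topCoeff n (omegaFS ζ ^ n) := by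
  rw [omegaFS_eq_ddc]
  exact ((formCont_ddc contDiff_fsPot).pow n).continuous _

theorem norm_sq_le_sum {n : ℕ} (ζ : Aff n) : ‖ζ‖ ^ 2 ≤ ∑ a, ‖ζ a‖ ^ 2 := by
  rcases isEmpty_or_nonempty (Fin n) with h | h
  · have : ‖ζ‖ = 0 := by rw [norm_eq_zero]; exact Subsingleton.elim _ _
    rw [this]
    simp
  · obtain ⟨a, ha⟩ := Finite.exists_max fun a => ‖ζ a‖
    have : ‖ζ‖ ≤ ‖ζ a‖ := (pi_norm_le_iff_of_nonneg (norm_nonneg _)).mpr ha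
    calc ‖ζ‖ ^ 2 ≤ ‖ζ a‖ ^ 2 := by gcongr
      _ ≤ _ := Finset.single_le_sum (f := fun a => ‖ζ a‖ ^ 2) (fun _ _ => by positivity)
        (Finset.mem_univ a)

theorem integrable_topCoeff_omegaFS_pow (n : ℕ) :
    Integrable fun ζ : Aff n => topCoeff n (omegaFS ζ ^ n) := by
  obtain ⟨c, hc⟩ := topCoeff_omegaFS_pow n
  -- The decay exponent `2n + 2` exceeds the real dimension `2n`.
  have hi : Integrable fun ζ : Aff n => (1 + ‖ζ‖ ^ 2) ^ (-(2 * n + 2 : ℝ) / 2) :=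
    integrable_rpow_neg_one_add_norm_sq (by
      rw [Module.finrank_pi_fintype]
      simp
      linarith)
  refine (hi.const_mul |c|).mono' (continuous_topCoeff_omegaFS_pow n).aestronglyMeasurable
    (Filter.Eventually.of_forall fun ζ => ?_)
  rw [hc, norm_mul, Real.norm_eq_abs]
  refine mul_le_mul_of_nonneg_left ?_ (abs_nonneg c)
  have h1 : (1 + ‖ζ‖ ^ 2) ^ (-(2 * n + 2 : ℝ) / 2) = ((1 + ‖ζ‖ ^ 2) ^ (n + 1))⁻¹ := by
    rw [show (-(2 * n + 2 : ℝ) / 2) = -((n + 1 : ℕ) : ℝ) by push_cast; ring,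
      Real.rpow_neg (by positivity), Real.rpow_natCast]
  rw [h1, Real.norm_of_nonneg (by positivity)]
  gcongr
  exact norm_sq_le_sum ζ

/-! ### A smooth ramp function -/

/-- A smooth convex function that vanishes on `(-∞, 0]` and has slope `1` on `[1, ∞)`. -/
def ramp (x : ℝ) : ℝ := ∫ y in (0 : ℝ)..x, Real.smoothTransition y

theorem hasDerivAt_ramp (x : ℝ) : HasDerivAt ramp (Real.smoothTransition x) x :=
  intervalIntegral.integral_hasDerivAt_right
    (Real.smoothTransition.continuous.intervalIntegrable _ _)
    (Real.smoothTransition.continuous.stronglyMeasurableAtFilter _ _)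
    Real.smoothTransition.continuous.continuousAt

theorem contDiff_ramp : ContDiff ℝ 2 ramp := by
  rw [show (2 : WithTop ℕ∞) = 1 + 1 by norm_num, contDiff_succ_iff_deriv]
  refine ⟨fun x => (hasDerivAt_ramp x).differentiableAt, by simp, ?_⟩
  rw [show deriv ramp = Real.smoothTransition from funext fun x => (hasDerivAt_ramp x).deriv]
  exact Real.smoothTransition.contDiff

theorem ramp_of_nonpos {x : ℝ} (hx : x ≤ 0) : ramp x = 0 := by
  rw [ramp, intervalIntegral.integral_symm, neg_eq_zero]
  refine (intervalIntegral.integral_congr (g := fun _ => 0) fun y hy => ?_).trans (by simp)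
  rw [uIcc_of_le hx] at hy
  exact Real.smoothTransition.zero_of_nonpos hy.2

theorem hasDerivAt_smoothTransition (x : ℝ) :
    HasDerivAt Real.smoothTransition (deriv Real.smoothTransition x) x :=
  ((Real.smoothTransition.contDiff (n := 1)).differentiable (by norm_num) x).hasDerivAt

theorem deriv_smoothTransition_nonneg (x : ℝ) : 0 ≤ deriv Real.smoothTransition x :=
  Real.smoothTransition.monotone.deriv_nonneg

theorem deriv_smoothTransition_of_one_lt {x : ℝ} (hx : 1 < x) :
    deriv Real.smoothTransition x = 0 := by
  have : Real.smoothTransition =ᶠ[nhds x] fun _ => 1 := by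
    filter_upwards [lt_mem_nhds hx] with y hy using Real.smoothTransition.one_of_one_le hy.le
  rw [this.deriv_eq, deriv_const]

theorem hessian_comp {n : ℕ} {h h' h'' : ℝ → ℝ} (hh : ∀ x, HasDerivAt h (h' x) x)
    (hh' : ∀ x, HasDerivAt h' (h'' x) x) {q : Aff n → ℝ} (hq : ContDiff ℝ 2 q) (ζ : Aff n) :
    fderiv ℝ (fderiv ℝ fun ξ => h (q ξ)) ζ = h' (q ζ) • fderiv ℝ (fderiv ℝ q) ζ +
      h'' (q ζ) • (fderiv ℝ q ζ).smulRight (fderiv ℝ q ζ) := by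
  have hq1 (ξ) : HasFDerivAt q (fderiv ℝ q ξ) ξ := (hq.differentiable (by norm_num) ξ).hasFDerivAt
  have hq2 : HasFDerivAt (fderiv ℝ q) (fderiv ℝ (fderiv ℝ q) ζ) ζ :=
    ((hq.fderiv_right (m := 1) (by norm_num)).differentiable (by norm_num) ζ).hasFDerivAt
  have h1 : fderiv ℝ (fun ξ => h (q ξ)) = fun ξ => h' (q ξ) • fderiv ℝ q ξ :=
    funext fun ξ => ((hh (q ξ)).comp_hasFDerivAt ξ (hq1 ξ)).fderiv
  rw [h1]
  have h2 := ((hh' (q ζ)).comp_hasFDerivAt ζ (hq1 ζ)).smul hq2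
  rw [HasFDerivAt.fderiv (f := fun ξ => h' (q ξ) • fderiv ℝ q ξ) h2]
  ext v w
  simp [mul_assoc]

/-! ### Comparison of masses -/

theorem isCompact_fsPot_le {n : ℕ} (c : ℝ) : IsCompact {ζ : Aff n | fsPot ζ ≤ c} := by
  refine Metric.isCompact_of_isClosed_isBounded
    (isClosed_le (contDiff_fsPot (k := 0)).continuous continuous_const) ?_
  refine (Metric.isBounded_closedBall (x := (0 : Aff n)) (r := Real.exp c)).subset fun ζ hζ => ?_
  rw [mem_closedBall_zero_iff]
  have h1 : Real.log (1 + ∑ a, ‖ζ a‖ ^ 2) ≤ 2 * c := by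
    have : 1 / 2 * Real.log (1 + ∑ a, ‖ζ a‖ ^ 2) ≤ c := hζ
    linarith
  have h2 := (Real.log_le_iff_le_exp (one_add_sum_pos ζ)).mp h1
  refine abs_le_of_sq_le_sq' ?_ (Real.exp_pos c).le |>.2
  rw [← Real.exp_nat_mul]
  push_cast
  linarith [norm_sq_le_sum ζ]

theorem commute_omegaFS {n : ℕ} (ζ : Aff n) (Ψ : Forms n) : Commute (omegaFS ζ) Ψ := by
  rw [omegaFS_eq_hessForm]
  exact commute_hessForm _ _

/-- In the binomial expansion every term containing `dd^c g` is exact with compactly supported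
primitive, up to mollification, and integrates to zero; only `m^k ω^n` survives. -/
theorem integral_omegaFS_pow_mul_add_ddc_pow {n : ℕ} {g : Aff n → ℝ} (hg : ContDiff ℝ 2 g)
    (hs : HasCompactSupport g) (m : ℝ) {k : ℕ} (hk : k ≤ n) :
    Integrable (fun ζ => topCoeff n (omegaFS ζ ^ (n - k) * (ddc g ζ + m • omegaFS ζ) ^ k)) ∧
      ∫ ζ, topCoeff n (omegaFS ζ ^ (n - k) * (ddc g ζ + m • omegaFS ζ) ^ k) =
        m ^ k * ∫ ζ : Aff n, topCoeff n (omegaFS ζ ^ n) := by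
  have expand (ζ) : topCoeff n (omegaFS ζ ^ (n - k) * (ddc g ζ + m • omegaFS ζ) ^ k) =
      ∑ j ∈ Finset.range (k + 1), (m ^ (k - j) * (k.choose j : ℝ)) *
        topCoeff n (ddc g ζ ^ j * ddc fsPot ζ ^ (n - j)) := by
    have hc : Commute (ddc g ζ) (m • omegaFS ζ) := ((commute_omegaFS ζ _).smul_left m).symm
    rw [hc.add_pow, Finset.mul_sum, map_sum]
    refine Finset.sum_congr rfl fun j hj => ?_
    rw [Finset.mem_range] at hj
    have hw : omegaFS ζ ^ (n - k) * (ddc g ζ ^ j * omegaFS ζ ^ (k - j)) =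
        ddc g ζ ^ j * omegaFS ζ ^ (n - j) := by
      rw [← mul_assoc, ((commute_omegaFS ζ (ddc g ζ ^ j)).pow_left (n - k)).eq, mul_assoc,
        ← pow_add, show n - k + (k - j) = n - j by omega]
    rw [← nsmul_eq_mul', ← Nat.cast_smul_eq_nsmul ℝ, smul_pow, mul_smul_comm, mul_smul_comm,
      mul_smul_comm, smul_smul, hw, map_smul, smul_eq_mul, mul_comm (k.choose j : ℝ),
      omegaFS_eq_ddc]
  have hz (j) : Integrable (fun ζ => topCoeff n (ddc g ζ ^ j * ddc fsPot ζ ^ (n - j))) ∧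
      ∫ ζ, topCoeff n (ddc g ζ ^ j * ddc fsPot ζ ^ (n - j)) =
        if j = 0 then ∫ ζ : Aff n, topCoeff n (omegaFS ζ ^ n) else 0 := by
    cases j with
    | zero =>
      simp only [pow_zero, one_mul, Nat.sub_zero, ← omegaFS_eq_ddc, if_true, and_true]
      exact integrable_topCoeff_omegaFS_pow n
    | succ j =>
      simpa using integral_ddc_pow_mul_eq_zero hg hs contDiff_fsPot (n - (j + 1)) j (topCoeff n)
  simp only [expand]
  constructor
  · exact integrable_finsetSum _ fun j _ => (hz j).1.const_mul _
  · rw [integral_finsetSum _ fun j _ => (hz j).1.const_mul _]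
    simp only [integral_const_mul, (hz _).2]
    rw [Finset.sum_eq_single 0]
    · simp
    · intro j _ hj
      simp [hj]
    · simp

section Comparison

variable {n : ℕ} {F : Aff n → ℝ} {M : ℝ}

theorem continuous_topCoeff_omegaFS_pow_mul (hF : ContDiff ℝ 2 F) {a : Aff n → ℝ}
    (ha : Continuous a) (i k : ℕ) :
    Continuous fun ζ => topCoeff n (omegaFS ζ ^ i * (a ζ • omegaFS ζ + ddc F ζ) ^ k) := by
  have hω : FormCont (omegaFS (n := n)) := omegaFS_eq_ddc ▸ formCont_ddc contDiff_fsPot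
  have hF' := (hω.smul ha).add (formCont_ddc hF)
  exact ((hω.pow i).mul (hF'.pow k)).continuous _

theorem posForm_smul_omegaFS_add_ddc (hF : ContDiff ℝ 2 F) {ζ : Aff n}
    (hL : ∀ v, 0 ≤ M * levi (fderiv ℝ (fderiv ℝ fsPot) ζ) v + levi (fderiv ℝ (fderiv ℝ F) ζ) v) :
    PosForm (M • omegaFS ζ + ddc F ζ) := by
  rw [omegaFS_eq_hessForm, ddc_eq_hessForm hF, ← map_smul, ← map_add]
  refine posForm_hessForm _ (fun v w => ?_) fun v => ?_
  · simp only [add_apply, smul_apply, isSymm_hessian hF ζ v, isSymm_hessian contDiff_fsPot ζ v]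
  · rw [levi_add, levi_smul]
    exact hL v

/-- Subtracting `δ · fsPot` makes the bounded `F` tend to `-∞` at infinity, so after adding a
constant the convex function `ramp` cuts it off to a compactly supported `g`. The price is `δ`: the
form `dd^c g + (M + δ) ω` is semipositive everywhere, has mass exactly `(M + δ)^k ∫ ω^n`, and equals
`M ω + dd^c F` on the ball. -/
theorem setIntegral_topCoeff_le (hF : ContDiff ℝ 2 F) {C : ℝ} (hC : ∀ ζ, |F ζ| ≤ C) (hM : 0 ≤ M)
    (hL : ∀ ζ v, 0 ≤ M * levi (fderiv ℝ (fderiv ℝ fsPot) ζ) v + levi (fderiv ℝ (fderiv ℝ F) ζ) v)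
    {k : ℕ} (hk : k ≤ n) {δ : ℝ} (hδ : 0 < δ) (R : ℝ) :
    ∫ ζ in Metric.closedBall 0 R, topCoeff n (omegaFS ζ ^ (n - k) * (M • omegaFS ζ + ddc F ζ) ^ k) ≤
      (M + δ) ^ k * ∫ ζ : Aff n, topCoeff n (omegaFS ζ ^ n) := by
  obtain ⟨D, hD⟩ := (isCompact_closedBall (0 : Aff n) R).exists_bound_of_continuousOn
    (contDiff_fsPot (k := 0)).continuous.continuousOn
  -- On the ball `F ≥ -C` and `fsPot ≤ D`, so `q ≥ 2` there, in the range where `ramp` has slope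
  -- `1`.
  set q : Aff n → ℝ := fun ζ => F ζ - δ * fsPot ζ + (2 + C + δ * D) with hq
  have hqc : ContDiff ℝ 2 q := (hF.sub (contDiff_const.mul contDiff_fsPot)).add contDiff_const
  set g : Aff n → ℝ := fun ζ => ramp (q ζ) with hg
  have hgc : ContDiff ℝ 2 g := contDiff_ramp.comp hqc
  have hgs : HasCompactSupport g := by
    refine HasCompactSupport.intro (isCompact_fsPot_le ((C + (2 + C + δ * D)) / δ)) fun ζ hζ => ?_
    refine ramp_of_nonpos ?_
    rw [mem_ofPred_eq, not_le, div_lt_iff₀ hδ] at hζ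
    have := (abs_le.mp (hC ζ)).2
    simp only [hq]
    linarith
  have hq2 (ζ) : fderiv ℝ (fderiv ℝ q) ζ =
      fderiv ℝ (fderiv ℝ F) ζ + (-δ) • fderiv ℝ (fderiv ℝ fsPot) ζ := by
    have h1 : fderiv ℝ q = fun ξ => fderiv ℝ F ξ + (-δ) • fderiv ℝ fsPot ξ := by
      ext1 ξ
      have a1 := (hF.differentiable (by norm_num) ξ).hasFDerivAt
      have a2 := ((contDiff_fsPot (n := n) (k := 2)).differentiable (by norm_num) ξ).hasFDerivAt
      have a3 : HasFDerivAt q _ ξ := (a1.sub (a2.const_mul δ)).add_const (2 + C + δ * D)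
      rw [a3.fderiv]
      ext v
      simp only [add_apply, sub_apply, smul_apply, smul_eq_mul]
      ring
    rw [h1]
    have b1 := ((hF.fderiv_right (m := 1) (by norm_num)).differentiable (by norm_num) ζ).hasFDerivAt
    have b2 := (((contDiff_fsPot (n := n) (k := 2)).fderiv_right (m := 1) (by norm_num)).differentiable
      (by norm_num) ζ).hasFDerivAt
    exact (b1.add (b2.const_smul (-δ))).fderiv
  have hg2 (ζ) : fderiv ℝ (fderiv ℝ g) ζ = _ :=
    hessian_comp hasDerivAt_ramp hasDerivAt_smoothTransition hqc ζ
  have hpos (ζ) : 0 ≤ topCoeff n (omegaFS ζ ^ (n - k) * (ddc g ζ + (M + δ) • omegaFS ζ) ^ k) := by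
    refine topCoeff_pow_mul_pow_nonneg (posForm_omegaFS ζ) ?_ (by omega)
    rw [add_comm]
    refine posForm_smul_omegaFS_add_ddc hgc fun v => ?_
    rw [hg2, hq2, levi_add, levi_smul, levi_smul, levi_add, levi_smul]
    have e1 := Real.smoothTransition.nonneg (q ζ)
    have e2 := Real.smoothTransition.le_one (q ζ)
    have e3 := mul_nonneg (deriv_smoothTransition_nonneg (q ζ))
      (levi_smulRight_self_nonneg (fderiv ℝ q ζ) v)
    have e4 := mul_nonneg e1 (hL ζ v)
    -- With `r = ramp'(q)`, the Levi form splits as `r (M ω + F) + (1 - r)(M + δ) ω` plus the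
    -- nonnegative convexity term, in the notation where forms stand for their Levi forms.
    have e5 := mul_nonneg (mul_nonneg (sub_nonneg.mpr e2) (add_nonneg hM hδ.le))
      (levi_hessian_fsPot_nonneg ζ v)
    linarith
  have heq : ∀ ζ ∈ Metric.closedBall (0 : Aff n) R,
      topCoeff n (omegaFS ζ ^ (n - k) * (M • omegaFS ζ + ddc F ζ) ^ k) =
        topCoeff n (omegaFS ζ ^ (n - k) * (ddc g ζ + (M + δ) • omegaFS ζ) ^ k) := by
    intro ζ hζ
    have hq1 : 1 < q ζ := by
      have h1 := (abs_le.mp (hC ζ)).1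
      have h2 := mul_le_mul_of_nonneg_left ((le_abs_self _).trans (hD ζ hζ)) hδ.le
      simp only [hq]
      linarith
    rw [ddc_eq_hessForm hgc, hg2, deriv_smoothTransition_of_one_lt hq1,
      Real.smoothTransition.one_of_one_le hq1.le, hq2, one_smul, map_add, map_add,
      map_smul, map_smul, zero_smul, add_zero, ← ddc_eq_hessForm hF, ← omegaFS_eq_hessForm,
      add_smul, neg_smul]
    congr 3
    abel
  obtain ⟨hi, he⟩ := integral_omegaFS_pow_mul_add_ddc_pow hgc hgs (M + δ) hk
  rw [← he, setIntegral_congr_fun Metric.isClosed_closedBall.measurableSet heq]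
  exact setIntegral_le_integral hi (Filter.Eventually.of_forall hpos)

-- Let `δ → 0` on each ball, then exhaust by balls; nonnegativity of the integrand gives
-- integrability from the uniform bound.
open Filter Topology in
theorem integral_omegaFS_pow_mul_le (hF : ContDiff ℝ 2 F) {C : ℝ} (hC : ∀ ζ, |F ζ| ≤ C)
    (hM : 0 ≤ M)
    (hL : ∀ ζ v, 0 ≤ M * levi (fderiv ℝ (fderiv ℝ fsPot) ζ) v + levi (fderiv ℝ (fderiv ℝ F) ζ) v)
    {k : ℕ} (hk : k ≤ n) :
    Integrable (fun ζ => topCoeff n (omegaFS ζ ^ (n - k) * (M • omegaFS ζ + ddc F ζ) ^ k)) ∧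
      ∫ ζ, topCoeff n (omegaFS ζ ^ (n - k) * (M • omegaFS ζ + ddc F ζ) ^ k) ≤
        M ^ k * ∫ ζ : Aff n, topCoeff n (omegaFS ζ ^ n) := by
  have hb (R : ℝ) : ∫ ζ in Metric.closedBall 0 R,
      topCoeff n (omegaFS ζ ^ (n - k) * (M • omegaFS ζ + ddc F ζ) ^ k) ≤
        M ^ k * ∫ ζ : Aff n, topCoeff n (omegaFS ζ ^ n) := by
    have hc : Continuous fun δ : ℝ => (M + δ) ^ k * ∫ ζ : Aff n, topCoeff n (omegaFS ζ ^ n) := by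
      fun_prop
    have ht : Tendsto (fun δ : ℝ => (M + δ) ^ k * ∫ ζ : Aff n, topCoeff n (omegaFS ζ ^ n))
        (𝓝[>] 0) (𝓝 (M ^ k * ∫ ζ : Aff n, topCoeff n (omegaFS ζ ^ n))) := by
      have := (hc.tendsto 0).mono_left (nhdsWithin_le_nhds (s := Ioi 0))
      rwa [add_zero] at this
    refine ge_of_tendsto ht ?_
    filter_upwards [self_mem_nhdsWithin] with δ hδ
    exact setIntegral_topCoeff_le hF hC hM hL hk hδ R
  have hcont := continuous_topCoeff_omegaFS_pow_mul hF (continuous_const (y := M)) (n - k) k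
  have hnn : ∀ ζ, 0 ≤ topCoeff n (omegaFS ζ ^ (n - k) * (M • omegaFS ζ + ddc F ζ) ^ k) := fun ζ =>
    topCoeff_pow_mul_pow_nonneg (posForm_omegaFS ζ) (posForm_smul_omegaFS_add_ddc hF (hL ζ))
      (by omega)
  have hcov : AECover (volume : Measure (Aff n)) atTop
      fun i : ℕ => Metric.closedBall (0 : Aff n) (i : ℝ) :=
    aecover_closedBall tendsto_natCast_atTop_atTop
  have hint := hcov.integrable_of_integral_bounded_of_nonneg_ae _
    (fun i => (hcont.continuousOn.integrableOn_compact (isCompact_closedBall _ _)))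
    (Eventually.of_forall hnn) (Eventually.of_forall fun i => hb i)
  exact ⟨hint, le_of_tendsto (hcov.integral_tendsto_of_countably_generated hint)
    (Eventually.of_forall fun i => hb i)⟩

end Comparison

/-! ### The mass estimate -/

theorem bell_succ_eq_sum (k : ℕ) :
    Nat.bell (k + 1) = ∑ j ∈ Finset.range (k + 1), k.choose j * Nat.bell j := by
  rw [Nat.bell_succ, ← Nat.range_succ_eq_Iic, ← Finset.sum_range_reflect]
  refine Finset.sum_congr rfl fun j hj => ?_
  rw [Finset.mem_range] at hj
  rw [show k + 1 - 1 - j = k - j by omega, Nat.choose_symm (by omega),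
    show k - (k - j) = j by omega]

theorem bell_pos (k : ℕ) : 0 < Nat.bell k := by
  induction k using Nat.strong_induction_on with
  | _ k ih =>
    cases k with
    | zero => simp
    | succ k =>
      rw [bell_succ_eq_sum]
      exact Finset.sum_pos (fun j hj => Nat.mul_pos
        (Nat.choose_pos (by rw [Finset.mem_range] at hj; omega)) (ih j (by simpa using hj)))
        ⟨0, by simp⟩

theorem le_bell (k : ℕ) : k ≤ Nat.bell k := by
  induction k with
  | zero => simp
  | succ k ih =>
    rcases Nat.eq_zero_or_pos k with rfl | hk
    · exact bell_pos 1
    · rw [bell_succ_eq_sum, Finset.sum_range_succ]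
      -- The term `j = k` of the recursion is `Nat.bell k`, so the other terms only have to
      -- contribute `1`.
      have : 1 ≤ ∑ j ∈ Finset.range k, k.choose j * Nat.bell j :=
        Finset.sum_pos (fun j hj => Nat.mul_pos
          (Nat.choose_pos (by rw [Finset.mem_range] at hj; omega)) (bell_pos j)) ⟨0, by simpa⟩
      rw [Nat.choose_self, one_mul]
      omega

theorem pow_sub_sub_pow_le {M a : ℝ} (ha : 0 ≤ a) (haM : a ≤ M) (k : ℕ) :
    M ^ (k + 1) - (M - a) ^ (k + 1) ≤ (k + 1 : ℕ) * M ^ k * a := by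
  have hM : 0 ≤ M := ha.trans haM
  induction k with
  | zero => simp
  | succ k ih =>
    have h1 : (M - a) ^ (k + 1) ≤ M ^ (k + 1) :=
      pow_le_pow_left₀ (by linarith) (by linarith) _
    have h2 := mul_le_mul_of_nonneg_left ih hM
    have h3 := mul_le_mul_of_nonneg_right h1 ha
    push_cast at h2 ⊢
    calc M ^ (k + 1 + 1) - (M - a) ^ (k + 1 + 1)
        = M * (M ^ (k + 1) - (M - a) ^ (k + 1)) + (M - a) ^ (k + 1) * a := by ring
      _ ≤ M * ((k + 1) * M ^ k * a) + M ^ (k + 1) * a := add_le_add h2 h3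
      _ = _ := by ring

section Mass

variable {n : ℕ} {F a : Aff n → ℝ} {M : ℝ}

/-- Expand `β = (M - a) ω + Θ`. All mixed terms are nonnegative, and the pure `Θ` and pure `ω` terms
are kept; they are distinct because the exponent is at least `1`. -/
theorem topCoeff_add_le (hF : ContDiff ℝ 2 F) {ζ : Aff n} (haM : a ζ ≤ M)
    (hL : ∀ v, 0 ≤ a ζ * levi (fderiv ℝ (fderiv ℝ fsPot) ζ) v + levi (fderiv ℝ (fderiv ℝ F) ζ) v)
    {k : ℕ} (hk : k + 1 ≤ n) :
    topCoeff n (omegaFS ζ ^ (n - (k + 1)) * (a ζ • omegaFS ζ + ddc F ζ) ^ (k + 1)) +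
        (M - a ζ) ^ (k + 1) * topCoeff n (omegaFS ζ ^ n) ≤
      topCoeff n (omegaFS ζ ^ (n - (k + 1)) * (M • omegaFS ζ + ddc F ζ) ^ (k + 1)) := by
  have hΘ := posForm_smul_omegaFS_add_ddc hF hL
  set Θ := a ζ • omegaFS ζ + ddc F ζ
  have hβ : M • omegaFS ζ + ddc F ζ = (M - a ζ) • omegaFS ζ + Θ := by
    rw [← add_assoc, ← add_smul, sub_add_cancel]
  have hc : Commute ((M - a ζ) • omegaFS ζ) Θ := (commute_omegaFS ζ _).smul_left _
  have hterm (j) (hj : j ≤ k + 1) : omegaFS ζ ^ (n - (k + 1)) *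
      (((M - a ζ) • omegaFS ζ) ^ j * Θ ^ (k + 1 - j) * ((k + 1).choose j : Forms n)) =
        ((M - a ζ) ^ j * ((k + 1).choose j : ℝ)) •
          (omegaFS ζ ^ (n - (k + 1) + j) * Θ ^ (k + 1 - j)) := by
    rw [← nsmul_eq_mul', ← Nat.cast_smul_eq_nsmul ℝ, smul_pow, smul_mul_assoc, mul_smul_comm,
      mul_smul_comm, smul_smul, ← mul_assoc, ← pow_add, mul_comm ((k + 1).choose j : ℝ)]
  have hpos (j) (hj : j ≤ k + 1) :
      0 ≤ topCoeff n (omegaFS ζ ^ (n - (k + 1) + j) * Θ ^ (k + 1 - j)) :=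
    topCoeff_pow_mul_pow_nonneg (posForm_omegaFS ζ) hΘ (by omega)
  rw [hβ, hc.add_pow, Finset.mul_sum, map_sum, Finset.sum_range_succ, Finset.sum_range_succ',
    hterm _ le_rfl, hterm 0 (by omega)]
  simp only [map_smul, pow_zero, Nat.choose_zero_right, Nat.cast_one, mul_one, one_smul, add_zero,
    Nat.sub_zero, Nat.sub_self, Nat.choose_self, smul_eq_mul, Nat.sub_add_cancel hk]
  have : 0 ≤ ∑ j ∈ Finset.range k, topCoeff n (omegaFS ζ ^ (n - (k + 1)) *
      (((M - a ζ) • omegaFS ζ) ^ (j + 1) * Θ ^ (k + 1 - (j + 1)) *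
        ((k + 1).choose (j + 1) : Forms n))) := by
    refine Finset.sum_nonneg fun j hj => ?_
    rw [Finset.mem_range] at hj
    rw [hterm _ (by omega), map_smul, smul_eq_mul]
    exact mul_nonneg (mul_nonneg (pow_nonneg (sub_nonneg.mpr haM) _) (Nat.cast_nonneg _))
      (hpos _ (by omega))
  linarith

theorem integral_pow_smul_le (hF : ContDiff ℝ 2 F) {C : ℝ} (hC : ∀ ζ, |F ζ| ≤ C)
    (ha : Continuous a) (ha0 : ∀ ζ, 0 ≤ a ζ) (haM : ∀ ζ, a ζ ≤ M)
    (hL : ∀ ζ v, 0 ≤ a ζ * levi (fderiv ℝ (fderiv ℝ fsPot) ζ) v +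
      levi (fderiv ℝ (fderiv ℝ F) ζ) v) :
    IntegrableForm (fun ζ => a ζ • omegaFS ζ ^ n) ∧ ∀ k ≤ n,
      IntegrableForm (fun ζ => a ζ ^ (n + 1 - k) •
        (omegaFS ζ ^ (n - k) * (a ζ • omegaFS ζ + ddc F ζ) ^ k)) ∧
      integralCP (fun ζ => a ζ ^ (n + 1 - k) •
        (omegaFS ζ ^ (n - k) * (a ζ • omegaFS ζ + ddc F ζ) ^ k)) ≤
          (Nat.bell k : ℝ) * M ^ n * integralCP (fun ζ => a ζ • omegaFS ζ ^ n) := by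
  have hM : 0 ≤ M := (ha0 0).trans (haM 0)
  set W : Aff n → ℝ := fun ζ => topCoeff n (omegaFS ζ ^ n) with hW
  have hWi : Integrable W := integrable_topCoeff_omegaFS_pow n
  have hW0 (ζ) : 0 ≤ W ζ := by
    simpa using topCoeff_pow_mul_pow_nonneg (posForm_omegaFS ζ) (posForm_omegaFS ζ) (add_zero n)
  have hWc : Continuous W := continuous_topCoeff_omegaFS_pow n
  have hbdd {f : Aff n → ℝ} (hf : Continuous f) (hf0 : ∀ ζ, 0 ≤ f ζ) {c : ℝ}
      (hfc : ∀ ζ, f ζ ≤ c) {V : Aff n → ℝ} (hV : Integrable V) (hVc : Continuous V)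
      (hV0 : ∀ ζ, 0 ≤ V ζ) : Integrable fun ζ => f ζ * V ζ :=
    (hV.const_mul c).mono' (hf.mul hVc).aestronglyMeasurable (Filter.Eventually.of_forall fun ζ => by
      change ‖f ζ * V ζ‖ ≤ c * V ζ
      rw [Real.norm_of_nonneg (mul_nonneg (hf0 ζ) (hV0 ζ))]
      exact mul_le_mul_of_nonneg_right (hfc ζ) (hV0 ζ))
  have haW : Integrable fun ζ => a ζ * W ζ := hbdd ha ha0 haM hWi hWc hW0
  have hapow (j ζ) : a ζ ^ j ≤ M ^ j := pow_le_pow_left₀ (ha0 ζ) (haM ζ) j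
  simp only [IntegrableForm, integralCP, map_smul, smul_eq_mul]
  refine ⟨haW, fun k hk => ?_⟩
  rcases k with - | k
  · simp only [Nat.sub_zero, pow_zero, mul_one, Nat.bell_zero, Nat.cast_one, one_mul]
    have hi : Integrable fun ζ => a ζ ^ (n + 1) * W ζ :=
      hbdd (ha.pow _) (fun ζ => pow_nonneg (ha0 ζ) _) (hapow _) hWi hWc hW0
    refine ⟨hi, ?_⟩
    rw [← integral_const_mul]
    refine integral_mono hi (haW.const_mul _) fun ζ => ?_
    change a ζ ^ (n + 1) * W ζ ≤ M ^ n * (a ζ * W ζ)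
    rw [pow_succ, ← mul_assoc]
    exact mul_le_mul_of_nonneg_right (mul_le_mul_of_nonneg_right (hapow n ζ) (ha0 ζ)) (hW0 ζ)
  · set G : Aff n → ℝ := fun ζ =>
      topCoeff n (omegaFS ζ ^ (n - (k + 1)) * (a ζ • omegaFS ζ + ddc F ζ) ^ (k + 1)) with hG
    have hG0 (ζ) : 0 ≤ G ζ := topCoeff_pow_mul_pow_nonneg (posForm_omegaFS ζ)
      (posForm_smul_omegaFS_add_ddc hF (hL ζ)) (by omega)
    have hGc : Continuous G := continuous_topCoeff_omegaFS_pow_mul hF ha _ _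
    obtain ⟨hβi, hβ⟩ := integral_omegaFS_pow_mul_le hF hC hM (fun ζ v =>
      (hL ζ v).trans (add_le_add_left (mul_le_mul_of_nonneg_right (haM ζ)
        (levi_hessian_fsPot_nonneg ζ v)) _)) hk
    have hle (ζ) := topCoeff_add_le hF (haM ζ) (hL ζ) hk
    have hr0 (ζ) : 0 ≤ (M - a ζ) ^ (k + 1) := pow_nonneg (sub_nonneg.mpr (haM ζ)) _
    have hri : Integrable fun ζ => (M - a ζ) ^ (k + 1) * W ζ :=
      hbdd (by fun_prop) hr0 (fun ζ => pow_le_pow_left₀ (sub_nonneg.mpr (haM ζ))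
        (sub_le_self _ (ha0 ζ)) _) hWi hWc hW0
    have hGi : Integrable G := hβi.mono' hGc.aestronglyMeasurable
      (Filter.Eventually.of_forall fun ζ => by
        rw [Real.norm_of_nonneg (hG0 ζ)]
        exact (le_add_of_nonneg_right (mul_nonneg (hr0 ζ) (hW0 ζ))).trans (hle ζ))
    -- The kept term `(M - a)^(k+1) ω^n` nearly cancels the total mass `M^(k+1) ∫ ω^n`; the
    -- difference is linear in `a`, which produces the factor `∫ a ω^n`.
    have h1 : ∫ ζ, G ζ ≤ ((k + 1 : ℕ) * M ^ k) * ∫ ζ, a ζ * W ζ := by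
      have e1 : (∫ ζ, G ζ) + ∫ ζ, (M - a ζ) ^ (k + 1) * W ζ ≤ M ^ (k + 1) * ∫ ζ, W ζ := by
        rw [← integral_add hGi hri]
        exact (integral_mono (hGi.add hri) hβi hle).trans hβ
      have e2 : M ^ (k + 1) * ∫ ζ, W ζ ≤ ((k + 1 : ℕ) * M ^ k) * (∫ ζ, a ζ * W ζ) +
          ∫ ζ, (M - a ζ) ^ (k + 1) * W ζ := by
        rw [← integral_const_mul, ← integral_const_mul, ← integral_add (haW.const_mul _) hri]
        refine integral_mono (hWi.const_mul _) ((haW.const_mul _).add hri) fun ζ => ?_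
        change M ^ (k + 1) * W ζ ≤ (k + 1 : ℕ) * M ^ k * (a ζ * W ζ) + (M - a ζ) ^ (k + 1) * W ζ
        have := mul_le_mul_of_nonneg_right (pow_sub_sub_pow_le (ha0 ζ) (haM ζ) k) (hW0 ζ)
        linarith
      linarith
    have hi : Integrable fun ζ => a ζ ^ (n + 1 - (k + 1)) * G ζ :=
      hbdd (ha.pow _) (fun ζ => pow_nonneg (ha0 ζ) _) (hapow _) hGi hGc hG0
    refine ⟨hi, ?_⟩
    have haW0 : 0 ≤ ∫ ζ, a ζ * W ζ := integral_nonneg fun ζ => mul_nonneg (ha0 ζ) (hW0 ζ)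
    calc ∫ ζ, a ζ ^ (n + 1 - (k + 1)) * G ζ
        ≤ M ^ (n - k) * ∫ ζ, G ζ := by
          rw [← integral_const_mul]
          refine integral_mono hi (hGi.const_mul _) fun ζ => ?_
          rw [show n + 1 - (k + 1) = n - k by omega]
          exact mul_le_mul_of_nonneg_right (hapow _ ζ) (hG0 ζ)
      _ ≤ M ^ (n - k) * (((k + 1 : ℕ) * M ^ k) * ∫ ζ, a ζ * W ζ) :=
          mul_le_mul_of_nonneg_left h1 (pow_nonneg hM _)
      _ = (k + 1 : ℕ) * M ^ n * ∫ ζ, a ζ * W ζ := by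
          rw [show M ^ n = M ^ (n - k) * M ^ k by rw [← pow_add, Nat.sub_add_cancel (by omega)]]
          ring
      _ ≤ _ := by
          gcongr
          exact le_bell (k + 1)

end Mass

/-! ### Second order calculus -/

section Calculus

open Filter Topology

variable {V : Type*} [NormedAddCommGroup V] [NormedSpace ℝ V]

theorem hasFDerivAt_fderiv {f : V → ℝ} {z : V} (hf : ContDiffAt ℝ 2 f z) :
    HasFDerivAt (fderiv ℝ f) (fderiv ℝ (fderiv ℝ f) z) z :=
  ((hf.fderiv_right (m := 1) (by norm_num)).differentiableAt (by norm_num)).hasFDerivAt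

theorem eventually_hasFDerivAt {f : V → ℝ} {z : V} (hf : ContDiffAt ℝ 2 f z) :
    ∀ᶠ y in 𝓝 z, HasFDerivAt f (fderiv ℝ f y) y := by
  filter_upwards [hf.eventually (by simp)] with y hy
  exact (hy.differentiableAt (by norm_num)).hasFDerivAt

/-- The derivative of the remainder at `k` is the first order error of `fderiv ℝ f`, which is
`o(‖k‖)`; the mean value inequality on the ball of radius `‖h‖` gains the second power. -/
theorem taylor_two {f : V → ℝ} {z : V} (hf : ContDiffAt ℝ 2 f z) {ε : ℝ} (hε : 0 < ε) :
    ∃ δ > 0, ∀ h : V, ‖h‖ ≤ δ →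
      |f (z + h) - f z - fderiv ℝ f z h - (1 / 2) * fderiv ℝ (fderiv ℝ f) z h h| ≤ ε * ‖h‖ ^ 2 := by
  have h1 := (hasFDerivAt_fderiv hf).isLittleO.def hε
  have h2 := eventually_hasFDerivAt hf
  obtain ⟨δ, hδ, hball⟩ := Metric.eventually_nhds_iff_ball.mp (h1.and h2)
  have hsymm : ∀ v w, fderiv ℝ (fderiv ℝ f) z v w = fderiv ℝ (fderiv ℝ f) z w v :=
    hf.isSymmSndFDerivAt (by simp)
  refine ⟨δ / 2, by positivity, fun h hh => ?_⟩
  set g : V → ℝ := fun k => f (z + k) - f z - fderiv ℝ f z k -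
    (1 / 2) * fderiv ℝ (fderiv ℝ f) z k k with hg
  have hgd : ∀ k ∈ Metric.closedBall (0 : V) ‖h‖, HasFDerivWithinAt g
      (fderiv ℝ f (z + k) - fderiv ℝ f z - fderiv ℝ (fderiv ℝ f) z k)
        (Metric.closedBall 0 ‖h‖) k := by
    intro k hk
    rw [mem_closedBall_zero_iff] at hk
    have hzk : z + k ∈ Metric.ball z δ := by
      simp only [Metric.mem_ball, dist_self_add_left]
      linarith
    have a1 : HasFDerivAt (fun k => f (z + k)) (fderiv ℝ f (z + k)) k :=
      ((hball _ hzk).2.comp k ((hasFDerivAt_id k).const_add z)).congr_fderiv (by ext; rfl)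
    have a2 := ((fderiv ℝ (fderiv ℝ f) z).hasFDerivAt (x := k)).clm_apply (hasFDerivAt_id k)
    have a3 := (((a1.sub_const (f z)).sub (fderiv ℝ f z).hasFDerivAt).sub (a2.const_mul (1 / 2)))
    refine (a3.congr_fderiv ?_).hasFDerivWithinAt
    ext v
    simp [hsymm v k]
    ring
  have hgb : ∀ k ∈ Metric.closedBall (0 : V) ‖h‖,
      ‖fderiv ℝ f (z + k) - fderiv ℝ f z - fderiv ℝ (fderiv ℝ f) z k‖ ≤ ε * ‖h‖ := by
    intro k hk
    rw [mem_closedBall_zero_iff] at hk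
    have hzk : z + k ∈ Metric.ball z δ := by
      simp only [Metric.mem_ball, dist_self_add_left]
      linarith
    have := (hball _ hzk).1
    rw [add_sub_cancel_left] at this
    exact this.trans (mul_le_mul_of_nonneg_left hk hε.le)
  have := (convex_closedBall (0 : V) ‖h‖).norm_image_sub_le_of_norm_hasFDerivWithin_le hgd hgb
    (x := 0) (y := h) (by simp) (by simp)
  simp only [hg, map_zero, add_zero, sub_self, mul_zero, sub_zero, Real.norm_eq_abs] at this
  calc _ ≤ ε * ‖h‖ * ‖h‖ := this
    _ = _ := by ring

theorem hasDerivAt_comp_curve {f : V → ℝ} {γ γ' : ℝ → V} {t : ℝ}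
    (hf : ContDiffAt ℝ 2 f (γ t)) (h1 : ∀ᶠ s in 𝓝 t, HasDerivAt γ (γ' s) s) :
    ∀ᶠ s in 𝓝 t, HasDerivAt (fun s => f (γ s)) (fderiv ℝ f (γ s) (γ' s)) s := by
  have hc : Tendsto γ (𝓝 t) (𝓝 (γ t)) := h1.self_of_nhds.continuousAt
  filter_upwards [hc.eventually (eventually_hasFDerivAt hf), h1] with s hs hs'
  exact hs.comp_hasDerivAt s hs'

theorem hasDerivAt_fderiv_comp_curve {f : V → ℝ} {γ γ' : ℝ → V} {γ'' : V} {t : ℝ}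
    (hf : ContDiffAt ℝ 2 f (γ t)) (h1 : HasDerivAt γ (γ' t) t) (h2 : HasDerivAt γ' γ'' t) :
    HasDerivAt (fun s => fderiv ℝ f (γ s) (γ' s))
      (fderiv ℝ (fderiv ℝ f) (γ t) (γ' t) (γ' t) + fderiv ℝ f (γ t) γ'') t :=
  ((hasFDerivAt_fderiv hf).comp_hasDerivAt t h1).clm_apply h2

/-- Two curves along which two functions agree have the same second derivatives of these
functions. -/
theorem second_deriv_eq_of_comp_eq {W : Type*} [NormedAddCommGroup W] [NormedSpace ℝ W]
    {f : V → ℝ} {g : W → ℝ} {γ γ' : ℝ → V} {γ'' : V} {η η' : ℝ → W} {η'' : W} {t : ℝ}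
    (hf : ContDiffAt ℝ 2 f (γ t)) (hg : ContDiffAt ℝ 2 g (η t))
    (h1 : ∀ᶠ s in 𝓝 t, HasDerivAt γ (γ' s) s) (h2 : HasDerivAt γ' γ'' t)
    (k1 : ∀ᶠ s in 𝓝 t, HasDerivAt η (η' s) s) (k2 : HasDerivAt η' η'' t)
    (h : ∀ᶠ s in 𝓝 t, f (γ s) = g (η s)) :
    fderiv ℝ (fderiv ℝ f) (γ t) (γ' t) (γ' t) + fderiv ℝ f (γ t) γ'' =
      fderiv ℝ (fderiv ℝ g) (η t) (η' t) (η' t) + fderiv ℝ g (η t) η'' := by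
  have e : (fun s => fderiv ℝ f (γ s) (γ' s)) =ᶠ[𝓝 t] fun s => fderiv ℝ g (η s) (η' s) := by
    filter_upwards [hasDerivAt_comp_curve hf h1, hasDerivAt_comp_curve hg k1,
      h.eventually_nhds] with s a b c
    have c' : (fun s => f (γ s)) =ᶠ[𝓝 s] fun s => g (η s) := c
    exact a.unique (b.congr_of_eventuallyEq c')
  exact (hasDerivAt_fderiv_comp_curve hf h1.self_of_nhds h2).unique
    ((hasDerivAt_fderiv_comp_curve hg k1.self_of_nhds k2).congr_of_eventuallyEq e)

theorem integral_trig_polynomial (c₀ c₁ c₂ c₃ c₄ c₅ : ℝ) :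
    (∫ θ in (0 : ℝ)..2 * Real.pi, (c₀ + c₁ * Real.cos θ + c₂ * Real.sin θ + c₃ * Real.cos θ ^ 2 +
      c₄ * (Real.sin θ * Real.cos θ) + c₅ * Real.sin θ ^ 2)) =
        2 * Real.pi * c₀ + Real.pi * (c₃ + c₅) := by
  have hi {g : ℝ → ℝ} (hg : Continuous g) : IntervalIntegrable g volume 0 (2 * Real.pi) :=
    hg.intervalIntegrable _ _
  rw [intervalIntegral.integral_add (hi (by fun_prop)) (hi (by fun_prop)),
    intervalIntegral.integral_add (hi (by fun_prop)) (hi (by fun_prop)),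
    intervalIntegral.integral_add (hi (by fun_prop)) (hi (by fun_prop)),
    intervalIntegral.integral_add (hi (by fun_prop)) (hi (by fun_prop)),
    intervalIntegral.integral_add (hi (by fun_prop)) (hi (by fun_prop))]
  simp only [intervalIntegral.integral_const_mul, intervalIntegral.integral_const, integral_cos,
    integral_sin, integral_cos_sq, integral_sin_sq, integral_sin_mul_cos₁, Real.sin_two_pi,
    Real.cos_two_pi, Real.sin_zero, Real.cos_zero, smul_eq_mul]
  ring

/-- Averaging the second order Taylor expansion over a circle removes the linear and mixed terms and
leaves a positive multiple of the Levi form, up to a small error. -/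
theorem levi_nonneg_of_le_mean [NormedSpace ℂ V] [IsScalarTower ℝ ℂ V] {f : V → ℝ} {z : V}
    (hf : ContDiffAt ℝ 2 f z) {r : ℝ} (hr : 0 < r)
    (hc : ContinuousOn f (Metric.closedBall z r))
    (h : ∀ w : V, ‖w‖ ≤ r → 2 * Real.pi * f z ≤
      ∫ θ in (0 : ℝ)..2 * Real.pi, f (z + Complex.exp (θ * Complex.I) • w)) (w : V) :
    0 ≤ fderiv ℝ (fderiv ℝ f) z w w +
      fderiv ℝ (fderiv ℝ f) z (Complex.I • w) (Complex.I • w) := by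
  rcases eq_or_ne w 0 with rfl | hw
  · simp
  have hw' : 0 < ‖w‖ := norm_pos_iff.mpr hw
  set A := fderiv ℝ (fderiv ℝ f) z w w
  set B := fderiv ℝ (fderiv ℝ f) z w (Complex.I • w)
  set B' := fderiv ℝ (fderiv ℝ f) z (Complex.I • w) w
  set D := fderiv ℝ (fderiv ℝ f) z (Complex.I • w) (Complex.I • w)
  refine le_of_forall_pos_le_add fun ε hε => ?_
  -- On the circle of radius `ρ ‖w‖` this error is `ε ρ² / 4`, whose integral `π ρ² ε / 2` has the
  -- same prefactor as `A + D`.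
  obtain ⟨δ, hδ, htay⟩ := taylor_two hf (ε := ε / (4 * ‖w‖ ^ 2)) (by positivity)
  set ρ : ℝ := min δ r / ‖w‖ with hρ
  have hρ0 : 0 < ρ := div_pos (lt_min hδ hr) hw'
  have hco (x : ℝ) (v : V) : (x : ℂ) • v = x • v := algebraMap_smul ℂ x v
  have hexp (θ : ℝ) : Complex.exp (θ * Complex.I) • ρ • w =
      (ρ * Real.cos θ) • w + (ρ * Real.sin θ) • Complex.I • w := by
    rw [Complex.exp_mul_I, ← Complex.ofReal_cos, ← Complex.ofReal_sin, add_smul, mul_smul,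
      hco, hco, smul_comm Complex.I ρ w, smul_smul, smul_smul,
      mul_comm ρ, mul_comm ρ]
  have hnorm (θ : ℝ) : ‖Complex.exp (θ * Complex.I) • ρ • w‖ = min δ r := by
    rw [norm_smul, Complex.norm_exp_ofReal_mul_I, one_mul, norm_smul, Real.norm_of_nonneg hρ0.le,
      hρ, div_mul_cancel₀ _ hw'.ne']
  have hpt (θ : ℝ) : f (z + Complex.exp (θ * Complex.I) • ρ • w) ≤
      f z + ρ * fderiv ℝ f z w * Real.cos θ + ρ * fderiv ℝ f z (Complex.I • w) * Real.sin θ +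
        ρ ^ 2 / 2 * A * Real.cos θ ^ 2 + ρ ^ 2 / 2 * (B + B') * (Real.sin θ * Real.cos θ) +
          ρ ^ 2 / 2 * D * Real.sin θ ^ 2 + ε / 4 * ρ ^ 2 := by
    have := (abs_le.mp (htay _ ((hnorm θ).trans_le (min_le_left _ _)))).2
    have hn2 : ε / (4 * ‖w‖ ^ 2) * ‖Complex.exp (θ * Complex.I) • ρ • w‖ ^ 2 = ε / 4 * ρ ^ 2 := by
      rw [hnorm, hρ]
      field_simp
    rw [hn2, hexp] at this
    rw [hexp]
    simp only [map_add, map_smul, add_apply, smul_apply, smul_eq_mul] at this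
    linarith
  have hcurve : ContinuousOn (fun θ : ℝ => f (z + Complex.exp (θ * Complex.I) • ρ • w))
      (uIcc 0 (2 * Real.pi)) := by
    refine hc.comp (by fun_prop) fun θ _ => ?_
    rw [Metric.mem_closedBall, dist_self_add_left, hnorm]
    exact min_le_right _ _
  have hint := intervalIntegral.integral_mono_on (μ := volume) (by positivity)
    hcurve.intervalIntegrable
    (Continuous.intervalIntegrable (by fun_prop) _ _) fun θ _ => hpt θ
  have hle : ‖ρ • w‖ ≤ r := by
    have := hnorm 0
    rw [norm_smul, Complex.norm_exp_ofReal_mul_I, one_mul] at this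
    exact this.trans_le (min_le_right _ _)
  have := (h (ρ • w) hle).trans hint
  have e := integral_trig_polynomial (f z + ε / 4 * ρ ^ 2) (ρ * fderiv ℝ f z w)
    (ρ * fderiv ℝ f z (Complex.I • w)) (ρ ^ 2 / 2 * A) (ρ ^ 2 / 2 * (B + B')) (ρ ^ 2 / 2 * D)
  have e' := this.trans_eq ((intervalIntegral.integral_congr fun θ _ => by ring).trans e)
  have hπ := Real.pi_pos
  have : 0 ≤ (Real.pi * ρ ^ 2 / 2) * (A + D + ε) := by linarith
  exact nonneg_of_mul_nonneg_right this (by positivity)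

end Calculus

/-! ### Circular plurisubharmonic functions on the punctured ball -/

section PuncturedBall

open Filter Topology

variable {n : ℕ} {u : Amb n → EReal}

theorem isOpen_puncturedBall : IsOpen (Metric.ball (0 : Amb n) 1 \ {0}) :=
  Metric.isOpen_ball.sdiff isClosed_singleton

theorem MemFInfty.contDiffAt (hu : MemFInfty u) {z : Amb n} (hz : z ∈ Metric.ball 0 1 \ {0}) :
    ContDiffAt ℝ 2 (fun z => (u z).toReal) z :=
  hu.contDiffOn.contDiffAt (isOpen_puncturedBall.mem_nhds hz)

theorem MemFInfty.coe_toReal (hu : MemFInfty u) {z : Amb n} (hz : z ∈ Metric.ball 0 1 \ {0}) :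
    ((u z).toReal : EReal) = u z :=
  EReal.coe_toReal (hu.psh.lt_top z hz.1).ne (hu.ne_bot z hz)

theorem MemFInfty.apply_smul (hu : MemFInfty u) {z : Amb n} (hz : z ∈ Metric.ball 0 1) {c : ℂ}
    (hc : ‖c‖ = 1) : u (c • z) = u z := by
  have := Complex.norm_mul_exp_arg_mul_I c
  rw [hc, Complex.ofReal_one, one_mul] at this
  rw [← this]
  exact hu.invariant z hz _

theorem circleMean_coe {g : Amb n → ℝ} {z w : Amb n} 
    (hg : Continuous fun θ : ℝ => g (z + Complex.exp (θ * Complex.I) • w))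
    (h : ∀ θ : ℝ, u (z + Complex.exp (θ * Complex.I) • w) =
      (g (z + Complex.exp (θ * Complex.I) • w) : EReal)) :
    circleMean u z w = (((2 * Real.pi)⁻¹ *
      ∫ θ in (0 : ℝ)..2 * Real.pi, g (z + Complex.exp (θ * Complex.I) • w) : ℝ) : EReal) := by
  set G : ℝ → ℝ := fun θ => g (z + Complex.exp (θ * Complex.I) • w) with hG
  have hi : Integrable G (volume.restrict (Ioc 0 (2 * Real.pi))) := by
    have := hg.intervalIntegrable (μ := volume) 0 (2 * Real.pi)
    rwa [intervalIntegrable_iff_integrableOn_Ioc_of_le (by positivity)] at this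
  have hP : ∫⁻ θ in Ioc (0 : ℝ) (2 * Real.pi), ENNReal.ofReal (G θ) ≠ ⊤ := 
    hi.lintegral_lt_top.ne
  have hN : ∫⁻ θ in Ioc (0 : ℝ) (2 * Real.pi), ENNReal.ofReal (-G θ) ≠ ⊤ :=
    hi.neg.lintegral_lt_top.ne
  have h1 (θ : ℝ) : (u (z + Complex.exp (θ * Complex.I) • w)).toENNReal =
      ENNReal.ofReal (G θ) := by
    rw [h, EReal.toENNReal_of_ne_top (EReal.coe_ne_top _), EReal.toReal_coe]
  have h2 (θ : ℝ) : (-u (z + Complex.exp (θ * Complex.I) • w)).toENNReal =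
      ENNReal.ofReal (-G θ) := by
    rw [h, ← EReal.coe_neg, EReal.toENNReal_of_ne_top (EReal.coe_ne_top _), EReal.toReal_coe]
  have key (x : ENNReal) (hx : x ≠ ⊤) :
      (((ENNReal.ofReal (2 * Real.pi))⁻¹ * x : ENNReal) : EReal) =
        (((2 * Real.pi)⁻¹ * x.toReal : ℝ) : EReal) := by
    have hfin : (ENNReal.ofReal (2 * Real.pi))⁻¹ * x ≠ ⊤ :=
      ENNReal.mul_ne_top (by simp [Real.pi_pos]) hx
    rw [← EReal.coe_ennreal_toReal hfin, ENNReal.toReal_mul, ENNReal.toReal_inv,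
      ENNReal.toReal_ofReal (by positivity)]
  rw [circleMean]
  simp_rw [h1, h2]
  rw [key _ hP, key _ hN, ← EReal.coe_sub, intervalIntegral.integral_of_le (by positivity),
    integral_eq_lintegral_pos_part_sub_lintegral_neg_part hi, mul_sub]

theorem MemFInfty.levi_nonneg (hu : MemFInfty u) {z : Amb n} (hz : z ∈ Metric.ball 0 1 \ {0})
    (w : Amb n) :
    0 ≤ fderiv ℝ (fderiv ℝ fun z => (u z).toReal) z w w +
      fderiv ℝ (fderiv ℝ fun z => (u z).toReal) z (Complex.I • w) (Complex.I • w) := by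
  obtain ⟨r, hr, hball⟩ := Metric.nhds_basis_closedBall.mem_iff.mp
    (isOpen_puncturedBall.mem_nhds hz)
  have hcont : ContinuousOn (fun z => (u z).toReal) (Metric.closedBall z r) :=
    hu.contDiffOn.continuousOn.mono hball
  refine levi_nonneg_of_le_mean (hu.contDiffAt hz) hr hcont (fun w hw => ?_) w
  have hmem (c : ℂ) (hc : ‖c‖ ≤ 1) : z + c • w ∈ Metric.closedBall z r := by
    rw [Metric.mem_closedBall, dist_self_add_left, norm_smul]
    exact (mul_le_of_le_one_left (norm_nonneg _) hc).trans hw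
  have hmem' (θ : ℝ) := hmem (Complex.exp (θ * Complex.I)) (Complex.norm_exp_ofReal_mul_I θ).le
  have := hu.psh.le_circleMean z w fun c hc => (hball (hmem c hc)).1
  rw [circleMean_coe (g := fun z => (u z).toReal) (hcont.comp_continuous (by fun_prop) hmem')
    fun θ => (hu.coe_toReal (hball (hmem' θ))).symm, ← hu.coe_toReal hz,
    EReal.coe_le_coe_iff] at this
  rwa [← le_inv_mul_iff₀ (by positivity)]

/-- Differentiate the constant function `θ ↦ u(e^{iθ} p)` twice at `θ = 0`: the velocity is `i p`
and the acceleration is `-p`. -/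
theorem MemFInfty.hessian_I_smul_self (hu : MemFInfty u) {p : Amb n}
    (hp : p ∈ Metric.ball 0 1 \ {0}) :
    fderiv ℝ (fderiv ℝ fun z => (u z).toReal) p (Complex.I • p) (Complex.I • p) =
      fderiv ℝ (fun z => (u z).toReal) p p := by
  have hexp (θ : ℝ) : HasDerivAt (fun θ : ℝ => Complex.exp (θ * Complex.I))
      (Complex.exp (θ * Complex.I) * Complex.I) θ := by
    simpa using ((hasDerivAt_id (θ : ℂ)).comp_ofReal.mul_const Complex.I).cexp
  have := second_deriv_eq_of_comp_eq (f := fun z => (u z).toReal) (g := fun z => (u z).toReal)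
    (γ := fun θ : ℝ => Complex.exp (θ * Complex.I) • p)
    (γ' := fun θ : ℝ => (Complex.exp (θ * Complex.I) * Complex.I) • p)
    (γ'' := (Complex.exp ((0 : ℝ) * Complex.I) * Complex.I * Complex.I) • p)
    (η := fun _ => p) (η' := fun _ => 0) (η'' := 0) (t := 0)
    (by simpa using hu.contDiffAt hp) (hu.contDiffAt hp)
    (.of_forall fun θ => (hexp θ).smul_const p)
    (((hexp 0).mul_const Complex.I).smul_const p)
    (.of_forall fun θ => hasDerivAt_const _ _) (hasDerivAt_const _ _)
    (.of_forall fun θ => congrArg EReal.toReal (hu.invariant p hp.1 θ))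
  simp at this
  linarith

/-! ### Restriction to rays -/

theorem exp_smul_mem {z : Amb n} (hz : ‖z‖ = 1) {s : ℝ} (hs : s < 0) :
    Real.exp s • z ∈ Metric.ball (0 : Amb n) 1 \ {0} := by
  have hz0 : z ≠ 0 := by
    rintro rfl
    simp at hz
  refine ⟨?_, by simp [hz0]⟩
  rw [mem_ball_zero_iff, norm_smul, hz, mul_one, Real.norm_of_nonneg (Real.exp_pos s).le]
  exact Real.exp_lt_one_iff.mpr hs

theorem hasDerivAt_exp_smul (z : Amb n) (s : ℝ) :
    HasDerivAt (fun s : ℝ => Real.exp s • z) (Real.exp s • z) s :=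
  (Real.hasDerivAt_exp s).smul_const z

theorem MemFInfty.hasDerivAt_ray (hu : MemFInfty u) {z : Amb n} (hz : ‖z‖ = 1) {s : ℝ}
    (hs : s < 0) :
    HasDerivAt (fun s => (u (Real.exp s • z)).toReal)
      (fderiv ℝ (fun z => (u z).toReal) (Real.exp s • z) (Real.exp s • z)) s :=
  (hasDerivAt_comp_curve (f := fun z => (u z).toReal) (γ := fun s : ℝ => Real.exp s • z)
    (hu.contDiffAt (exp_smul_mem hz hs)) (.of_forall (hasDerivAt_exp_smul z))).self_of_nhds

/-- Along a ray, `u` is a convex function of `log ‖z‖`. -/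
theorem MemFInfty.monotoneOn_fderiv_ray (hu : MemFInfty u) {z : Amb n} (hz : ‖z‖ = 1) :
    MonotoneOn (fun s : ℝ => fderiv ℝ (fun z => (u z).toReal) (Real.exp s • z) (Real.exp s • z))
      (Iio 0) := by
  have hd : ∀ s < 0, HasDerivAt
      (fun s : ℝ => fderiv ℝ (fun z => (u z).toReal) (Real.exp s • z) (Real.exp s • z)) _ s :=
    fun s hs => hasDerivAt_fderiv_comp_curve (f := fun z => (u z).toReal)
      (γ := fun s : ℝ => Real.exp s • z) (γ' := fun s : ℝ => Real.exp s • z)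
      (hu.contDiffAt (exp_smul_mem hz hs)) (hasDerivAt_exp_smul z s) (hasDerivAt_exp_smul z s)
  refine monotoneOn_of_deriv_nonneg (convex_Iio 0)
    (fun s hs => (hd s hs).continuousAt.continuousWithinAt)
    (fun s hs => ?_) fun s hs => ?_
  · rw [interior_Iio] at hs
    exact (hd s hs).differentiableAt.differentiableWithinAt
  · rw [interior_Iio] at hs
    -- At `p = e^s z` the second derivative in `s` is `D²u(p, p) + Du(p)`, and circular invariance
    -- turns the last term into `D²u(ip, ip)`.
    rw [(hd s hs).deriv, ← hu.hessian_I_smul_self (exp_smul_mem hz hs)]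
    exact hu.levi_nonneg (exp_smul_mem hz hs) _

/-- A convex function of `s` with a negative slope somewhere tends to `+∞` as `s → -∞`, but upper
semicontinuity at the origin and `u 0 < ⊤` bound `u` above near the origin. -/
theorem MemFInfty.fderiv_ray_nonneg (hu : MemFInfty u) {z : Amb n} (hz : ‖z‖ = 1) {s : ℝ}
    (hs : s < 0) :
    0 ≤ fderiv ℝ (fun z => (u z).toReal) (Real.exp s • z) (Real.exp s • z) := by
  by_contra! hneg
  set w := fun s : ℝ => fderiv ℝ (fun z => (u z).toReal) (Real.exp s • z) (Real.exp s • z)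
  set v := fun s : ℝ => (u (Real.exp s • z)).toReal
  have h0 : (0 : Amb n) ∈ Metric.ball (0 : Amb n) 1 := by simp
  obtain ⟨C, hC, -⟩ := EReal.lt_iff_exists_real_btwn.mp (hu.psh.lt_top 0 h0)
  have hev := hu.psh.usc 0 h0 C hC
  rw [Metric.isOpen_ball.nhdsWithin_eq h0] at hev
  have ht : Tendsto (fun s : ℝ => Real.exp s • z) atBot (𝓝 0) := by
    simpa using Real.tendsto_exp_atBot.smul_const z
  -- The last condition places `x` so far to the left that slope at most `w s` forces `v x ≥ C`.
  obtain ⟨x, hx1, hx2, hx3⟩ := ((ht.eventually hev).and ((eventually_le_atBot s).and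
    (eventually_le_atBot (s - (C - v s) / (-w s))))).exists
  have hmv := (convex_Iic s).image_sub_le_mul_sub_of_deriv_le (f := v) (C := w s)
    (fun y hy => (hu.hasDerivAt_ray hz (lt_of_le_of_lt hy hs)).continuousAt.continuousWithinAt)
    (fun y hy => by
      rw [interior_Iic] at hy
      exact (hu.hasDerivAt_ray hz (hy.trans hs)).differentiableAt.differentiableWithinAt)
    (fun y hy => by
      rw [interior_Iic] at hy
      rw [(hu.hasDerivAt_ray hz (hy.trans hs)).deriv]
      exact hu.monotoneOn_fderiv_ray hz (hy.trans hs) hs hy.le)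
    x hx2 s self_mem_Iic hx2
  have hvx : v x < C := by
    rw [← hu.coe_toReal (exp_smul_mem hz (hx2.trans_lt hs)), EReal.coe_lt_coe_iff] at hx1
    exact hx1
  have hws : w s < 0 := hneg
  have : (C - v s) / (-w s) ≤ s - x := by linarith
  rw [div_le_iff₀ (by linarith)] at this
  linarith

/-! ### The slices -/

theorem exists_slice_eq (u : Amb n → EReal) (ζ : CP n) :
    ∃ z : Amb n, ‖z‖ = 1 ∧ ∀ t, slice u t ζ = (u (Real.exp t • z)).toReal := by
  refine ⟨‖ζ.rep‖⁻¹ • ζ.rep, ?_, fun t => ?_⟩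
  · rw [norm_smul, norm_inv, norm_norm, inv_mul_cancel₀ (norm_ne_zero_iff.mpr ζ.rep_nonzero)]
  · rw [slice, smul_smul, ← div_eq_mul_inv, Complex.coe_smul]

/-- Normalized representatives of one line differ by a unit complex factor, which `u` does not see.
-/
theorem MemFInfty.slice_mk (hu : MemFInfty u) {w : Amb n} (hw : w ≠ 0) {t : ℝ} (ht : t < 0) :
    slice u t (Projectivization.mk ℂ w hw) = (u (Real.exp t • ‖w‖⁻¹ • w)).toReal := by
  obtain ⟨a, ha⟩ := Projectivization.exists_smul_eq_mk_rep ℂ w hw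
  have hw' : ‖w‖ ≠ 0 := norm_ne_zero_iff.mpr hw
  have ha0 : ‖(a : ℂ)‖ ≠ 0 := norm_ne_zero_iff.mpr a.ne_zero
  have h1 : ‖‖w‖⁻¹ • w‖ = 1 := by
    rw [norm_smul, norm_inv, norm_norm, inv_mul_cancel₀ hw']
  rw [slice, ← ha, ← hu.apply_smul (exp_smul_mem h1 ht).1 (c := a / ‖(a : ℂ)‖)
    (by rw [norm_div, Complex.norm_real, norm_norm, div_self ha0])]
  congr 2
  rw [Units.smul_def, norm_smul, ← Complex.coe_smul (Real.exp t), ← Complex.coe_smul ‖w‖⁻¹,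
    smul_smul, smul_smul, smul_smul]
  congr 1
  push_cast
  field_simp

theorem MemFInfty.hasDerivAt_slice_mk (hu : MemFInfty u) {w : Amb n} (hw : w ≠ 0) {t : ℝ}
    (ht : t < 0) :
    HasDerivAt (fun s => slice u s (Projectivization.mk ℂ w hw))
      (fderiv ℝ (fun z => (u z).toReal) (Real.exp t • ‖w‖⁻¹ • w) (Real.exp t • ‖w‖⁻¹ • w)) t := by
  have h1 : ‖‖w‖⁻¹ • w‖ = 1 := by
    rw [norm_smul, norm_inv, norm_norm, inv_mul_cancel₀ (norm_ne_zero_iff.mpr hw)]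
  refine (hu.hasDerivAt_ray h1 ht).congr_of_eventuallyEq ?_
  filter_upwards [Iio_mem_nhds ht] with s hs using hu.slice_mk hw hs

theorem MemFInfty.derivWithin_slice (hu : MemFInfty u) (ζ : CP n) {t : ℝ} (ht : t < 0) :
    derivWithin (fun s => slice u s ζ) (Ici t) t = sliceDeriv u t ζ := by
  obtain ⟨z, hz, h⟩ := exists_slice_eq u ζ
  simp only [sliceDeriv, h]
  exact (hu.hasDerivAt_ray hz ht).differentiableAt.derivWithin (uniqueDiffOn_Ici t t self_mem_Ici)

theorem MemFInfty.sliceDeriv_nonneg (hu : MemFInfty u) (ζ : CP n) {t : ℝ} (ht : t < 0) :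
    0 ≤ sliceDeriv u t ζ := by
  obtain ⟨z, hz, h⟩ := exists_slice_eq u ζ
  simp only [sliceDeriv, h]
  rw [(hu.hasDerivAt_ray hz ht).deriv]
  exact hu.fderiv_ray_nonneg hz ht

theorem MemFInfty.sliceDeriv_mono (hu : MemFInfty u) (ζ : CP n) :
    MonotoneOn (fun t => sliceDeriv u t ζ) (Iio 0) := by
  intro s hs t ht hst
  obtain ⟨z, hz, h⟩ := exists_slice_eq u ζ
  simp only [sliceDeriv, h]
  rw [(hu.hasDerivAt_ray hz hs).deriv, (hu.hasDerivAt_ray hz ht).deriv]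
  exact hu.monotoneOn_fderiv_ray hz hs ht hst

theorem MemFInfty.maxDirLelong_eq (hu : MemFInfty u) {A : ℝ} (hA : 0 < A) :
    maxDirLelong u A = ⨆ ζ : CP n, (sliceDeriv u (-A) ζ : EReal) := by
  simp only [maxDirLelong, hu.derivWithin_slice _ (neg_lt_zero.mpr hA)]

theorem MemFInfty.maxDirLelong_nonneg (hu : MemFInfty u) {A : ℝ} (hA : 0 < A) :
    0 ≤ maxDirLelong u A := by
  rw [hu.maxDirLelong_eq hA]
  refine le_iSup_of_le (chart 0) ?_
  exact_mod_cast hu.sliceDeriv_nonneg _ (neg_lt_zero.mpr hA)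

theorem sphere_exp_subset {t : ℝ} (ht : t < 0) :
    Metric.sphere (0 : Amb n) (Real.exp t) ⊆ Metric.ball 0 1 \ {0} := by
  intro z hz
  rw [mem_sphere_zero_iff_norm] at hz
  refine ⟨?_, ?_⟩
  · rw [mem_ball_zero_iff, hz]
    exact Real.exp_lt_one_iff.mpr ht
  · rintro rfl
    rw [norm_zero] at hz
    exact (Real.exp_pos t).ne hz

/-- The slopes at `-A` are values of the continuous function `z ↦ Du(z) z` on the compact sphere of
radius `e^{-A}`. -/
theorem MemFInfty.maxDirLelong_ne_top (hu : MemFInfty u) {A : ℝ} (hA : 0 < A) :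
    maxDirLelong u A ≠ ⊤ := by
  have hA' : -A < 0 := neg_lt_zero.mpr hA
  have hcont : ContinuousOn (fun z => fderiv ℝ (fun z => (u z).toReal) z z)
      (Metric.sphere (0 : Amb n) (Real.exp (-A))) :=
    ((hu.contDiffOn.continuousOn_fderiv_of_isOpen isOpen_puncturedBall (by norm_num)).mono
      (sphere_exp_subset hA')).clm_apply continuousOn_id
  obtain ⟨C, hC⟩ := ((isCompact_sphere _ _).image_of_continuousOn hcont).bddAbove
  rw [hu.maxDirLelong_eq hA]
  refine ne_top_of_le_ne_top (EReal.coe_ne_top C) (iSup_le fun ζ => ?_)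
  rw [EReal.coe_le_coe_iff]
  obtain ⟨z, hz, h⟩ := exists_slice_eq u ζ
  simp only [sliceDeriv, h]
  rw [(hu.hasDerivAt_ray hz hA').deriv]
  refine hC ⟨_, ?_, rfl⟩
  rw [mem_sphere_zero_iff_norm, norm_smul, hz, mul_one, Real.norm_of_nonneg (Real.exp_pos _).le]

theorem MemFInfty.sliceDeriv_le (hu : MemFInfty u) {A : ℝ} (hA : 0 < A) {t : ℝ} (ht : t < -A)
    (ζ : CP n) : sliceDeriv u t ζ ≤ (maxDirLelong u A).toReal := by
  have hA' : -A < 0 := neg_lt_zero.mpr hA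
  refine (hu.sliceDeriv_mono ζ (ht.trans hA') hA' ht.le).trans ?_
  rw [← EReal.coe_le_coe_iff, EReal.coe_toReal (hu.maxDirLelong_ne_top hA)
    (ne_bot_of_le_ne_bot EReal.zero_ne_bot (hu.maxDirLelong_nonneg hA)), hu.maxDirLelong_eq hA]
  exact le_iSup (fun ζ => (sliceDeriv u (-A) ζ : EReal)) ζ

end PuncturedBall

/-! ### The slices in the affine chart -/

section Chart

open Filter Topology

variable {n : ℕ} {u : Amb n → EReal}

/-- The vector `(1, ζ¹, …, ζⁿ)`. -/
def homog (ζ : Aff n) : Amb n := WithLp.toLp 2 (Fin.cons 1 ζ : Fin (n + 1) → ℂ)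

/-- The vector `(0, v¹, …, vⁿ)`. -/
def homogDir (n : ℕ) : Aff n →L[ℝ] Amb n :=
  LinearMap.toContinuousLinearMap
    { toFun := fun v => WithLp.toLp 2 (Fin.cons 0 v : Fin (n + 1) → ℂ)
      map_add' := fun v w => by
        ext i
        refine Fin.cases ?_ (fun j => ?_) i <;> simp
      map_smul' := fun c v => by
        ext i
        refine Fin.cases ?_ (fun j => ?_) i <;> simp }

theorem homogDir_apply (v : Aff n) :
    homogDir n v = WithLp.toLp 2 (Fin.cons 0 v : Fin (n + 1) → ℂ) := rfl

theorem homogDir_I_smul (v : Aff n) : homogDir n (Complex.I • v) = Complex.I • homogDir n v := by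
  simp only [homogDir_apply]
  ext i
  refine Fin.cases ?_ (fun j => ?_) i <;> simp

theorem homog_add (ζ v : Aff n) : homog (ζ + v) = homog ζ + homogDir n v := by
  simp only [homogDir_apply, homog]
  ext i
  refine Fin.cases ?_ (fun j => ?_) i <;> simp

theorem homog_ne_zero (ζ : Aff n) : homog ζ ≠ 0 := by
  intro h
  have h0 := congrArg (fun v : Amb n => v 0) h
  simp [homog] at h0

theorem chart_eq_mk (ζ : Aff n) : chart ζ = Projectivization.mk ℂ (homog ζ) (homog_ne_zero ζ) := rfl

theorem norm_homog (ζ : Aff n) : ‖homog ζ‖ = Real.exp (fsPot ζ) := by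
  have h : Real.exp (fsPot ζ) ^ 2 = 1 + ∑ a, ‖ζ a‖ ^ 2 := by
    rw [← Real.exp_nat_mul, fsPot, Nat.cast_ofNat, ← mul_assoc, mul_one_div_cancel two_ne_zero,
      one_mul, Real.exp_log (one_add_sum_pos ζ)]
  rw [← Real.sqrt_sq (Real.exp_pos (fsPot ζ)).le, h, EuclideanSpace.norm_eq, Fin.sum_univ_succ]
  simp [homog]

theorem contDiff_homog {k : WithTop ℕ∞} : ContDiff ℝ k (homog (n := n)) := by
  have : homog (n := n) = fun ζ => homog 0 + homogDir n ζ := by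
    ext1 ζ
    rw [← homog_add, zero_add]
  rw [this]
  fun_prop

/-- The point of norm `eᵗ` with positive first coordinate on the line `[1 : ζ]`. -/
def lineSection (t : ℝ) (ζ : Aff n) : Amb n := Real.exp (t - fsPot ζ) • homog ζ

theorem lineSection_eq (t : ℝ) (ζ : Aff n) :
    lineSection t ζ = Real.exp t • ‖homog ζ‖⁻¹ • homog ζ := by
  rw [lineSection, norm_homog, smul_smul, Real.exp_sub, div_eq_mul_inv]

theorem norm_lineSection (t : ℝ) (ζ : Aff n) : ‖lineSection t ζ‖ = Real.exp t := by
  rw [lineSection, norm_smul, norm_homog, Real.norm_of_nonneg (Real.exp_pos _).le, ← Real.exp_add,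
    sub_add_cancel]

theorem lineSection_mem_sphere (t : ℝ) (ζ : Aff n) :
    lineSection t ζ ∈ Metric.sphere (0 : Amb n) (Real.exp t) :=
  mem_sphere_zero_iff_norm.mpr (norm_lineSection t ζ)

theorem lineSection_mem {t : ℝ} (ht : t < 0) (ζ : Aff n) :
    lineSection t ζ ∈ Metric.ball (0 : Amb n) 1 \ {0} :=
  sphere_exp_subset ht (lineSection_mem_sphere t ζ)

theorem contDiff_lineSection (t : ℝ) {k : WithTop ℕ∞} : ContDiff ℝ k (lineSection (n := n) t) :=
  (contDiff_const.sub contDiff_fsPot).exp.smul contDiff_homog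

theorem MemFInfty.slice_chart (hu : MemFInfty u) {t : ℝ} (ht : t < 0) (ζ : Aff n) :
    slice u t (chart ζ) = (u (lineSection t ζ)).toReal := by
  rw [chart_eq_mk, hu.slice_mk _ ht, lineSection_eq]

theorem MemFInfty.sliceDeriv_chart (hu : MemFInfty u) {t : ℝ} (ht : t < 0) (ζ : Aff n) :
    sliceDeriv u t (chart ζ) =
      fderiv ℝ (fun z => (u z).toReal) (lineSection t ζ) (lineSection t ζ) := by
  rw [chart_eq_mk, sliceDeriv, (hu.hasDerivAt_slice_mk _ ht).deriv, lineSection_eq]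

theorem MemFInfty.contDiff_slice_chart (hu : MemFInfty u) {t : ℝ} (ht : t < 0) :
    ContDiff ℝ 2 fun ζ : Aff n => slice u t (chart ζ) := by
  simp only [hu.slice_chart ht]
  exact hu.contDiffOn.comp_contDiff (contDiff_lineSection t) (lineSection_mem ht)

theorem MemFInfty.continuous_sliceDeriv_chart (hu : MemFInfty u) {t : ℝ} (ht : t < 0) :
    Continuous fun ζ : Aff n => sliceDeriv u t (chart ζ) := by
  simp only [hu.sliceDeriv_chart ht]
  have hs := (contDiff_lineSection (n := n) t (k := 0)).continuous
  exact ((hu.contDiffOn.continuousOn_fderiv_of_isOpen isOpen_puncturedBall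
    (by norm_num)).comp_continuous hs (lineSection_mem ht)).clm_apply hs

theorem MemFInfty.exists_abs_slice_chart_le (hu : MemFInfty u) {t : ℝ} (ht : t < 0) :
    ∃ C, ∀ ζ : Aff n, |slice u t (chart ζ)| ≤ C := by
  obtain ⟨C, hC⟩ := (isCompact_sphere (0 : Amb n) (Real.exp t)).exists_bound_of_continuousOn
    (hu.contDiffOn.continuousOn.mono (sphere_exp_subset ht))
  refine ⟨C, fun ζ => ?_⟩
  rw [hu.slice_chart ht]
  exact hC _ (lineSection_mem_sphere t ζ)

/-- The derivative of `log` of a holomorphic normalizing factor of `lineSection`, in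
direction `w`. -/
def logFactor (ζ w : Aff n) : ℂ :=
  -fderiv ℝ fsPot ζ w + fderiv ℝ fsPot ζ (Complex.I • w) * Complex.I

/-- `logFactor ζ w` equals `-2 ∂fsPot(w)`, whence complex linearity in `w`. -/
theorem logFactor_I_smul (ζ w : Aff n) :
    logFactor ζ (Complex.I • w) = Complex.I * logFactor ζ w := by
  have : Complex.I • Complex.I • w = -w := by simp [smul_smul]
  rw [logFactor, logFactor, this, map_neg]
  push_cast
  linear_combination -(fderiv ℝ fsPot ζ (Complex.I • w) : ℂ) * Complex.I_sq

/-- The section `lineSection t` is not holomorphic. Along `ζ + x w` it is multiplied by the phase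
`e^{ixc}`, invisible to `u`, with `c` chosen to complete the logarithmic derivative of the real
factor `e^{t - fsPot}` to a complex linear function of `w`. Only the second derivative of `fsPot`
spoils the holomorphic pattern, and it yields the last term. -/
theorem MemFInfty.hessian_slice_chart (hu : MemFInfty u) {t : ℝ} (ht : t < 0) (ζ w : Aff n) :
    fderiv ℝ (fderiv ℝ fun ξ => slice u t (chart ξ)) ζ w w =
      fderiv ℝ (fderiv ℝ fun z => (u z).toReal) (lineSection t ζ)
          (Real.exp (t - fsPot ζ) • (logFactor ζ w • homog ζ + homogDir n w))
          (Real.exp (t - fsPot ζ) • (logFactor ζ w • homog ζ + homogDir n w)) +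
        fderiv ℝ (fun z => (u z).toReal) (lineSection t ζ)
          (Real.exp (t - fsPot ζ) •
            (logFactor ζ w ^ 2 • homog ζ + (2 * logFactor ζ w) • homogDir n w)) -
        sliceDeriv u t (chart ζ) * fderiv ℝ (fderiv ℝ fsPot) ζ w w := by
  have hη (x : ℝ) : HasDerivAt (fun x : ℝ => ζ + x • w) w x := by
    simpa using ((hasDerivAt_id x).smul_const w).const_add ζ
  set c : ℝ := fderiv ℝ fsPot ζ (Complex.I • w) with hc
  set l : ℝ → ℂ := fun x => ((t - fsPot (ζ + x • w) : ℝ) : ℂ) + (x * c : ℝ) * Complex.I with hl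
  set l' : ℝ → ℂ := fun x => ((-fderiv ℝ fsPot (ζ + x • w) w : ℝ) : ℂ) + (c : ℝ) * Complex.I
    with hl'
  have hφ : ContDiff ℝ 2 (fsPot (n := n)) := contDiff_fsPot
  have d1 (x : ℝ) : HasDerivAt l (l' x) x := by
    have h1 := ((hφ.differentiable (by norm_num)).differentiableAt.hasFDerivAt.comp_hasDerivAt x
      (hη x)).const_sub t
    have h2 := ((hasDerivAt_id x).mul_const c).ofReal_comp.mul_const Complex.I
    exact (h1.ofReal_comp.add h2).congr_deriv (by simp [hl'])
  have d2 : HasDerivAt l' ((-fderiv ℝ (fderiv ℝ fsPot) ζ w w : ℝ) : ℂ) 0 := by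
    have h1 := (hasDerivAt_fderiv_comp_curve (f := fsPot) (γ := fun x : ℝ => ζ + x • w)
      (γ' := fun _ => w) (γ'' := 0) (t := 0) hφ.contDiffAt (hη 0) (hasDerivAt_const _ _)).neg
    exact (h1.ofReal_comp.add_const ((c : ℂ) * Complex.I)).congr_deriv (by simp)
  have hh (x : ℝ) : HasDerivAt (fun x : ℝ => homog ζ + x • homogDir n w) (homogDir n w) x := by
    simpa using ((hasDerivAt_id x).smul_const (homogDir n w)).const_add (homog ζ)
  have e1 (x : ℝ) := (d1 x).cexp
  have g1 (x : ℝ) := (e1 x).smul (hh x)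
  have g2 := ((e1 0).smul_const (homogDir n w)).add (((e1 0).mul d2).smul (hh 0))
  have hinv (x : ℝ) : u (Complex.exp (l x) • (homog ζ + x • homogDir n w)) =
      u (lineSection t (ζ + x • w)) := by
    rw [← hu.apply_smul (lineSection_mem ht (ζ + x • w)).1
      (c := Complex.exp ((x * c : ℝ) * Complex.I)) (Complex.norm_exp_ofReal_mul_I _), lineSection,
      homog_add, map_smul, ← Complex.coe_smul (Real.exp _), smul_smul, Complex.ofReal_exp,
      ← Complex.exp_add, add_comm (_ * Complex.I)]
  have hl0 : Complex.exp (l 0) = (Real.exp (t - fsPot ζ) : ℝ) := by simp [hl]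
  have hl'0 : l' 0 = logFactor ζ w := by simp [hl', logFactor, hc]
  have hp : Complex.exp (l 0) • (homog ζ + (0 : ℝ) • homogDir n w) = lineSection t ζ := by
    rw [hl0, Complex.coe_smul, zero_smul, add_zero, lineSection]
  have key := second_deriv_eq_of_comp_eq (f := fun z => (u z).toReal)
    (g := fun ξ => slice u t (chart ξ)) (t := 0) (η := fun x : ℝ => ζ + x • w) (η' := fun _ => w)
    (η'' := 0) (γ := fun x : ℝ => Complex.exp (l x) • (homog ζ + x • homogDir n w))
    (by
      beta_reduce
      rw [hp]
      exact hu.contDiffAt (lineSection_mem ht ζ))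
    (hu.contDiff_slice_chart ht).contDiffAt (.of_forall g1) g2 (.of_forall hη)
    (hasDerivAt_const _ _)
    (.of_forall fun x => by beta_reduce; rw [hinv, hu.slice_chart ht])
  beta_reduce at key
  rw [hp, hl0, hl'0, zero_smul, zero_smul, add_zero, add_zero, map_zero, add_zero] at key
  have hpm : ((fun x => Complex.exp (l x)) * l') 0 =
      (Real.exp (t - fsPot ζ) : ℝ) * logFactor ζ w := by
    rw [Pi.mul_apply, hl0, hl'0]
  rw [hpm] at key
  set E : ℝ := Real.exp (t - fsPot ζ) with hE
  set H := fderiv ℝ (fderiv ℝ fsPot) ζ w w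
  have v1 : (E : ℂ) • homogDir n w + (E * logFactor ζ w) • homog ζ =
      E • (logFactor ζ w • homog ζ + homogDir n w) := by
    rw [← Complex.coe_smul]
    module
  have v2 : (E * logFactor ζ w) • homogDir n w + ((E * logFactor ζ w) • homogDir n w +
      (E * logFactor ζ w * logFactor ζ w + E * (-H : ℝ)) • homog ζ) =
        E • (logFactor ζ w ^ 2 • homog ζ + (2 * logFactor ζ w) • homogDir n w) +
          (-H) • lineSection t ζ := by
    rw [lineSection, ← hE, ← Complex.coe_smul, ← Complex.coe_smul, ← Complex.coe_smul]
    module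
  rw [← key, hu.sliceDeriv_chart ht, v1, v2,
    map_add (fderiv ℝ (fun z => (u z).toReal) (lineSection t ζ)), map_smul _ (-H), smul_eq_mul]
  ring

/-- Replacing `w` by `i w` multiplies the velocity by `i` and the acceleration term by `-1`. In the
sum the accelerations cancel, the velocities give a Levi form of `u`, and the Fubini–Study
contributions cancel the term `a ω`. -/
theorem MemFInfty.levi_slice_chart_nonneg (hu : MemFInfty u) {t : ℝ} (ht : t < 0) (ζ w : Aff n) :
    0 ≤ sliceDeriv u t (chart ζ) * levi (fderiv ℝ (fderiv ℝ fsPot) ζ) w +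
      levi (fderiv ℝ (fderiv ℝ fun ξ => slice u t (chart ξ)) ζ) w := by
  have h := hu.levi_nonneg (lineSection_mem ht ζ)
    (Real.exp (t - fsPot ζ) • (logFactor ζ w • homog ζ + homogDir n w))
  have h1 : Real.exp (t - fsPot ζ) • (logFactor ζ (Complex.I • w) • homog ζ +
      homogDir n (Complex.I • w)) =
        Complex.I • Real.exp (t - fsPot ζ) • (logFactor ζ w • homog ζ + homogDir n w) := by
    rw [logFactor_I_smul, homogDir_I_smul, mul_smul, ← smul_add, smul_comm]
  have h2 : Real.exp (t - fsPot ζ) • (logFactor ζ (Complex.I • w) ^ 2 • homog ζ +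
      (2 * logFactor ζ (Complex.I • w)) • homogDir n (Complex.I • w)) =
        -(Real.exp (t - fsPot ζ) • (logFactor ζ w ^ 2 • homog ζ +
          (2 * logFactor ζ w) • homogDir n w)) := by
    rw [logFactor_I_smul, homogDir_I_smul, ← smul_neg, neg_add, ← neg_smul, ← neg_smul, smul_smul]
    congr 3
    · linear_combination logFactor ζ w ^ 2 * Complex.I_sq
    · linear_combination 2 * logFactor ζ w * Complex.I_sq
  rw [levi, levi, mulI_apply, hu.hessian_slice_chart ht ζ w,
    hu.hessian_slice_chart ht ζ (Complex.I • w), h1, h2, map_neg]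
  linarith

end Chart

end ZeroMass

end

/-! ### The mass estimate for circular plurisubharmonic functions. -/

theorem lemma5p4 (n : ℕ) :
    ∃ B : ℕ → ℝ, (∀ k, 0 < B k) ∧ B 0 = 1 ∧
      (∀ k < n, B (k + 1) = ∑ j ∈ Finset.range (k + 1), (k.choose j : ℝ) * B j) ∧
      ∀ u : ZeroMass.Amb n → EReal, ZeroMass.MemFInfty u → ∀ A : ℝ, 0 < A →
        0 ≤ ZeroMass.maxDirLelong u A ∧ ZeroMass.maxDirLelong u A ≠ ⊤ ∧
        ∀ t : ℝ, t < -A →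
          ZeroMass.IntegrableForm (fun ζ : ZeroMass.Aff n =>
            ZeroMass.sliceDeriv u t (ZeroMass.chart ζ) • ZeroMass.omegaFS ζ ^ n) ∧
          ∀ k ≤ n,
            ZeroMass.IntegrableForm (fun ζ : ZeroMass.Aff n =>
              ZeroMass.sliceDeriv u t (ZeroMass.chart ζ) ^ (n + 1 - k) •
                (ZeroMass.omegaFS ζ ^ (n - k) * ZeroMass.Theta₂ u t ζ ^ k)) ∧
            ZeroMass.integralCP (fun ζ : ZeroMass.Aff n =>
              ZeroMass.sliceDeriv u t (ZeroMass.chart ζ) ^ (n + 1 - k) •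
                (ZeroMass.omegaFS ζ ^ (n - k) * ZeroMass.Theta₂ u t ζ ^ k)) ≤
              B k * (ZeroMass.maxDirLelong u A).toReal ^ n *
                ZeroMass.integralCP (fun ζ : ZeroMass.Aff n =>
                  ZeroMass.sliceDeriv u t (ZeroMass.chart ζ) • ZeroMass.omegaFS ζ ^ n) := by
  refine ⟨fun k => (Nat.bell k : ℝ), fun k => Nat.cast_pos.mpr (ZeroMass.bell_pos k), by simp,
    fun k _ => by
      beta_reduce
      exact_mod_cast ZeroMass.bell_succ_eq_sum k, fun u hu A hA =>
    ⟨hu.maxDirLelong_nonneg hA, hu.maxDirLelong_ne_top hA, fun t ht => ?_⟩⟩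
  have ht0 : t < 0 := ht.trans (neg_lt_zero.mpr hA)
  obtain ⟨C, hC⟩ := hu.exists_abs_slice_chart_le ht0
  exact ZeroMass.integral_pow_smul_le (hu.contDiff_slice_chart ht0) hC
    (hu.continuous_sliceDeriv_chart ht0) (fun ζ => hu.sliceDeriv_nonneg _ ht0)
    (fun ζ => hu.sliceDeriv_le hA ht _) (hu.levi_slice_chart_nonneg ht0)
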